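/- Let $\mathbb T^2=\mathbb R^2/\mathbb Z^2$ with Lebesgue measure $\mu$ and let $R^t(x_1,x_2)=(x_1+t,x_2)$. For $N,M\ge 1$ the $N\times M$ grid is the partition of $\mathbb T^2$ into the rectangles $[\frac iN,\frac{i+1}N)\times[\frac jM,\frac{j+1}M)$, $0\le i<N$, $0\le j<M$; a permutation of the grid is a bijection of $\mathbb T^2$ that carries each of its rectangles by a translation onto a rectangle of the grid. An (untwisted, abstract) AbC construction consists of positive integers $k_n,l_n,s_n$ $(n\ge 0)$ with $s_n^{k_n}\ge s_{n+1}$; integers $p_n\ge 0$, $q_n\ge 1$ with $q_0=1$, $p_{n+1}=p_nq_nk_nl_n+1$, $q_{n+1}=k_nl_nq_n^2$; and invertible measure preserving transformations $h_n$ of $\mathbb T^2$ such that $h_{n+1}$ is a permutation of the $k_nq_n\times s_{n+1}$ grid, commutes with $R^{1/q_n}$ and leaves each column $[\frac i{q_n},\frac{i+1}{q_n})\times\mathbb T$ $(0\le i<q_n)$ invariant. The integers $l_n$ are large, in the sense that $l_n\ge 2$ for all $n$ and $\sum_n 1/l_n<\infty$. Put $\alpha_n=p_n/q_n$, $H_n=h_0\circ\cdots\circ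 h_n$, $T_n=H_n\circ R^{\alpha_n}\circ H_n^{-1}$, and let $T$ be an invertible measure preserving transformation that is the limit of $T_n$ in the weak topology, i.e. $\mu(T_nA\,\triangle\,TA)\to0$ for every measurable $A$. Write $R^n_{0,j}=[0,\frac1{q_n})\times[\frac j{s_n},\frac{j+1}{s_n})$. Assume: (1) $s_n\to\infty$. (2) For all $n$, $s<s_{n+1}$ and $j<s_n$, exactly $k_n/s_n$ of the indices $t<k_n$ satisfy $h_{n+1}\big([\frac t{k_nq_n},\frac{t+1}{k_nq_n})\times[\frac s{s_{n+1}},\frac{s+1}{s_{n+1}})\big)\subseteq R^n_{0,j}$. Consequently each $s<s_{n+1}$ has a unique word $(j_0,\dots,j_{k_n-1})_s\in\{0,\dots,s_n-1\}^{k_n}$ such that the $t$-th of these images is contained in $R^n_{0,j_t}$ for all $t<k_n$. (3) For every $n$ the map $s\mapsto(j_0,\dots,j_{k_n-1})_s$ is one to one. For $0\le i<q_n$ let $d_i\in\{0,\dots,q_n-1\}$ satisfy $p_nd_i\equiv i \pmod{q_n}$. Every $t\in\{0,\dots,q_{n+1}-1\}$ is uniquely $t=ik_nl_nq_n+jl_nq_n+r$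 with $i<q_n$, $j<k_n$, $r<l_nq_n$; call $t$ a $b$-time if $r<q_n-d_i$ and an $e$-time if $r\ge l_nq_n-d_i$ (the positions of the letters $b$, $e$ inserted in the circular word $\prod_{i<q_n}\prod_{j<k_n}b^{q_n-d_i}w_j^{l_n-1}e^{d_i}$, where the words $w_j$ have length $q_n$). Let $B_{n+1}$ (resp. $E_{n+1}$) be the union of the sets $(R^{\alpha_{n+1}})^t([0,\frac1{q_{n+1}})\times\mathbb T)$ over all $b$-times (resp. $e$-times) $t$, let $B_0=E_0=\emptyset$, let $\Gamma_n$ be the set of $x$ with $H_m^{-1}(x)\notin B_m\cup E_m$ for all $m>n$, and put $$B=\{x:\exists m,\ x\in\Gamma_m,\ H_m^{-1}(x)\in B_m\},\qquad E=\{x:\exists m,\ x\in\Gamma_m,\ H_m^{-1}(x)\in E_m\},$$ $$A_i=H_0\big([0,1)\times[\tfrac i{s_0},\tfrac{i+1}{s_0})\big)\setminus(B\cup E)\qquad(0\le i<s_0).$$ Then $\mathcal Q=\{A_i:i<s_0\}\cup\{B,E\}$ is a measurable partition of $\mathbb T^2$, and $\mathcal Q$ generates $T$: the smallest $\sigma$-algebra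 containing the sets $T^i(P)$, $i\in\mathbb Z$, $P\in\mathcal Q$, is, modulo null sets, the $\sigma$-algebra of all measurable sets. -/

import Mathlib

open MeasureTheory Filter Topology

/-- The two dimensional torus `ℝ² / ℤ²`; `volume` on it is Lebesgue (probability) measure. -/
abbrev Torus : Type := UnitAddCircle × UnitAddCircle

/-- The circle rotation `R^t (x₁, x₂) = (x₁ + t, x₂)`. -/
noncomputable def rot (t : ℝ) (x : Torus) : Torus := (x.1 + (t : UnitAddCircle), x.2)

/-- The half open arc `[i/N, (i+1)/N)` of the circle (for `i ≥ N` it is the arc with index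
`i mod N`). -/
def arc (N i : ℕ) : Set UnitAddCircle :=
  (fun u : ℝ => (u : UnitAddCircle)) '' Set.Ico ((i : ℝ) / N) (((i : ℝ) + 1) / N)

/-- The rectangle `[i/N, (i+1)/N) × [j/M, (j+1)/M)`, an atom of the grid partition of the torus
into `N` columns and `M` rows. -/
def rect (N M i j : ℕ) : Set Torus := arc N i ×ˢ arc M j

/-- The column `[i/N, (i+1)/N) × 𝕋`. -/
def column (N i : ℕ) : Set Torus := arc N i ×ˢ Set.univ

/-- The bijection `h` is a permutation of the grid with `N` columns and `M` rows: every rectangle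
is carried by a translation onto a rectangle of the same grid. -/
def IsGridPermutation (N M : ℕ) (h : Torus ≃ᵐ Torus) : Prop :=
  ∀ i < N, ∀ j < M, ∃ i' < N, ∃ j' < M, ∀ x ∈ rect N M i j,
    h x = (x.1 + ((((i' : ℝ) - i) / N : ℝ) : UnitAddCircle),
      x.2 + ((((j' : ℝ) - j) / M : ℝ) : UnitAddCircle))

/-- An abstract untwisted AbC (approximation by conjugation) construction: the parameter
sequences and the conjugating maps `h n`. -/
structure AbC where
  k : ℕ → ℕ
  l : ℕ → ℕ
  s : ℕ → ℕ
  p : ℕ → ℕ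
  q : ℕ → ℕ
  h : ℕ → Torus ≃ᵐ Torus
  k_pos : ∀ n, 0 < k n
  l_pos : ∀ n, 0 < l n
  s_pos : ∀ n, 0 < s n
  q_zero : q 0 = 1
  p_succ : ∀ n, p (n + 1) = p n * q n * k n * l n + 1
  q_succ : ∀ n, q (n + 1) = k n * l n * q n ^ 2
  s_succ_le : ∀ n, s (n + 1) ≤ s n ^ k n
  h_measurePreserving : ∀ n, MeasurePreserving (h n) volume volume
  h_perm : ∀ n, IsGridPermutation (k n * q n) (s (n + 1)) (h (n + 1))
  h_comm : ∀ n x, h (n + 1) (rot (1 / (q n : ℝ)) x) = rot (1 / (q n : ℝ)) (h (n + 1) x)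
  h_untwisted : ∀ n, ∀ i < q n, h (n + 1) '' column (q n) i = column (q n) i

namespace AbC

/-- `α_n = p_n / q_n`. -/
noncomputable def α (D : AbC) (n : ℕ) : ℝ := (D.p n : ℝ) / D.q n

/-- `H_n = h_0 ∘ h_1 ∘ ⋯ ∘ h_n`. -/
noncomputable def H (D : AbC) : ℕ → (Torus ≃ᵐ Torus)
  | 0 => D.h 0
  | n + 1 => (D.h (n + 1)).trans (D.H n)

/-- The periodic approximations `T_n = H_n ∘ R^{α_n} ∘ H_n⁻¹`. -/
noncomputable def approx (D : AbC) (n : ℕ) (x : Torus) : Torus :=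
  D.H n (rot (D.α n) ((D.H n).symm x))

/-- `D.Sends n r t j`: the map `h_{n+1}` sends the rectangle
`[t/(k_n q_n), (t+1)/(k_n q_n)) × [r/s_{n+1}, (r+1)/s_{n+1})` into
`R^n_{0,j} = [0, 1/q_n) × [j/s_n, (j+1)/s_n)`. -/
def Sends (D : AbC) (n r t j : ℕ) : Prop :=
  D.h (n + 1) '' rect (D.k n * D.q n) (D.s (n + 1)) t r ⊆ rect (D.q n) (D.s n) 0 j

/-- First requirement: `s_n → ∞`. -/
def Requirement1 (D : AbC) : Prop := Tendsto D.s atTop atTop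

/-- Second requirement: for every row `r` of the new grid and every `j < s_n` there are exactly
`k_n / s_n` indices `t < k_n` for which `h_{n+1}` sends the `t`-th rectangle of the row into
`R^n_{0,j}`. -/
def Requirement2 (D : AbC) : Prop :=
  ∀ n, ∀ r < D.s (n + 1), ∀ j < D.s n,
    (({t : ℕ | t < D.k n ∧ D.Sends n r t j}.ncard : ℕ) : ℚ) = (D.k n : ℚ) / D.s n

/-- `w = (j_0, …, j_{k_n - 1})` is the word associated with the row `r < s_{n+1}`. -/
def IsWordOf (D : AbC) (n : ℕ) (r : Fin (D.s (n + 1))) (w : Fin (D.k n) → Fin (D.s n)) : Prop :=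
  ∀ t : Fin (D.k n), D.Sends n r t (w t)

/-- Third requirement: the map that takes a row to its word is one to one. -/
def Requirement3 (D : AbC) : Prop :=
  ∀ n (r r' : Fin (D.s (n + 1))) (w : Fin (D.k n) → Fin (D.s n)),
    D.IsWordOf n r w → D.IsWordOf n r' w → r = r'

/-- The times `t < q_{n+1}` that carry the letter `b` which the circular operator
`∏_{i < q_n} ∏_{j < k_n} b^{q_n - d_i} w_j^{l_n - 1} e^{d_i}` inserts, where `d_i < q_n` is given by
`p_n d_i ≡ i mod q_n`. Here `t = i k_n l_n q_n + j l_n q_n + r` with `r < l_n q_n`. -/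
def IsBTime (D : AbC) (n t : ℕ) : Prop :=
  ∃ i j r d : ℕ, i < D.q n ∧ j < D.k n ∧ r < D.l n * D.q n ∧
    t = i * (D.k n * D.l n * D.q n) + j * (D.l n * D.q n) + r ∧
    d < D.q n ∧ D.p n * d ≡ i [MOD D.q n] ∧ r < D.q n - d

/-- The times `t < q_{n+1}` that carry the letter `e` inserted by the same operator. -/
def IsETime (D : AbC) (n t : ℕ) : Prop :=
  ∃ i j r d : ℕ, i < D.q n ∧ j < D.k n ∧ r < D.l n * D.q n ∧
    t = i * (D.k n * D.l n * D.q n) + j * (D.l n * D.q n) + r ∧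
    d < D.q n ∧ D.p n * d ≡ i [MOD D.q n] ∧ D.l n * D.q n - d ≤ r

/-- `B_0 = ∅`, and `B_{n+1}` is the union of the levels `t` labelled by an inserted `b` of the
towers of `R^{α_{n+1}}`; the `t`-th levels `(R^{α_{n+1}})^t ([0, 1/q_{n+1}) × 𝕋)` form the column
with index `p_{n+1} t mod q_{n+1}`. -/
def stageB (D : AbC) : ℕ → Set Torus
  | 0 => ∅
  | n + 1 => {x | ∃ t, D.IsBTime n t ∧ x ∈ column (D.q (n + 1)) (D.p (n + 1) * t)}

/-- `E_0 = ∅`, and `E_{n+1}` is the union of the levels labelled by an inserted `e`. -/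
def stageE (D : AbC) : ℕ → Set Torus
  | 0 => ∅
  | n + 1 => {x | ∃ t, D.IsETime n t ∧ x ∈ column (D.q (n + 1)) (D.p (n + 1) * t)}

/-- `Γ_n`: the points that receive no inserted letter at any stage later than `n`. -/
def Γ (D : AbC) (n : ℕ) : Set Torus :=
  {x | ∀ m, n < m → (D.H m).symm x ∉ D.stageB m ∪ D.stageE m}

/-- `B`: the points whose last inserted letter is a `b`. -/
def setB (D : AbC) : Set Torus := {x | ∃ m, x ∈ D.Γ m ∧ (D.H m).symm x ∈ D.stageB m}

/-- `E`: the points whose last inserted letter is an `e`. -/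
def setE (D : AbC) : Set Torus := {x | ∃ m, x ∈ D.Γ m ∧ (D.H m).symm x ∈ D.stageE m}

/-- The alphabet `Σ ∪ {b, e}` with `Σ = {a_0, …, a_{m-1}}`. -/
inductive Letter (m : ℕ) : Type
  | a (i : Fin m) : Letter m
  | b : Letter m
  | e : Letter m

/-- The partition `Q = {A_i : i < s_0} ∪ {B, E}`, where
`A_i = H_0 ([0,1) × [i/s_0, (i+1)/s_0)) ∖ (B ∪ E)`. -/
def Q (D : AbC) : Letter (D.s 0) → Set Torus
  | .a i => D.H 0 '' rect 1 (D.s 0) 0 i \ (D.setB ∪ D.setE)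
  | .b => D.setB
  | .e => D.setE

end AbC

/-- `T` is the limit of the maps `S n` in the weak topology. -/
def IsWeakLimit {X : Type*} [MeasurableSpace X] (μ : Measure X) (S : ℕ → X → X) (T : X → X) :
    Prop :=
  ∀ A, MeasurableSet A → Tendsto (fun n => μ (symmDiff (S n '' A) (T '' A))) atTop (𝓝 0)

/-- An indexed measurable partition of a probability space (up to a null set). -/
structure IsMeasurablePartition {X ι : Type*} [MeasurableSpace X] (μ : Measure X)
    (P : ι → Set X) : Prop where
  measurableSet : ∀ a, MeasurableSet (P a)
  disjoint : Pairwise (fun a a' => Disjoint (P a) (P a'))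
  ae_mem : μ (⋃ a, P a)ᶜ = 0

/-- The partition `P` generates the transformation `T`: the smallest `T`-invariant σ-algebra
containing the atoms of `P` is, modulo null sets, the whole σ-algebra. -/
def Generates {X ι : Type*} [MeasurableSpace X] (μ : Measure X) (T : X ≃ᵐ X) (P : ι → Set X) :
    Prop :=
  ∀ A, MeasurableSet A → ∃ C,
    MeasurableSet[MeasurableSpace.generateFrom
      {S : Set X | ∃ (i : ℤ) (a : ι), S = ((T.toEquiv : Equiv.Perm X) ^ i) ⁻¹' P a}] C ∧
    A =ᵐ[μ] C

/-! The first coordinate of `H_n⁻¹ x` gives the level of `x` in the tower of `T_n`, the second its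
row. Each `h_{n+1}` translates the rectangles of its grid, and level and row at stage `n + 1`
determine both at stage `n`. Hence two points sharing level and row at all large stages have, under
`H_0⁻¹`, a difference with coordinates at most `1/q_n` and `1/s_n`, so they coincide
(`eq_of_forall_pos_row`). It remains to recover levels and rows from the itinerary.

For almost every `x`, every orbit point eventually (in the stage) moves up one level under `T` with
its row fixed, and receives only finitely many inserted letters (`ae_isRegular`). Both are
Borel–Cantelli arguments, with the convergent sums of `1/q_n` and `1/l_n`. The first is proved for
the maps `T_N` uniformly in `N` and carried to `T` by `IsWeakLimit.measure_le`. Such an orbit is a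
nested parsing into circular words, axiomatized in `IsCoding`.

The core is unique readability (`IsCoding.agree`), by induction on the stage. A word of stage `n +
1` opens with `b^{q_n}`, and `d_i = 0` only for `i = 0`, so this opening could be mistaken only for
that of a later run in the section `i = 0`; `start_transfer` excludes this too. Once the beginnings
agree, the subwords give the stage `n` rows, and Requirement 3 recovers the row of stage `n + 1`.

So the itinerary map is injective on a conull set, and the Lusin–Souslin theorem turns this into
generation (`generates_of_injOn`). -/

/-! ### Arcs of the circle -/

/-- The index of the arc `[i/N, (i+1)/N)` of the circle that contains `u`. -/
noncomputable def col (N : ℕ) (u : UnitAddCircle) : ℕ :=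
  ⌊(N : ℝ) * (AddCircle.equivIco (1 : ℝ) 0 u : ℝ)⌋₊

theorem exists_rep (u : UnitAddCircle) : ∃ v : ℝ, (v : UnitAddCircle) = u := by
  induction u using QuotientAddGroup.induction_on with
  | H v => exact ⟨v, rfl⟩

theorem col_coe (N : ℕ) (v : ℝ) : (col N (v : UnitAddCircle) : ℤ) = ⌊(N : ℝ) * v⌋ % N := by
  have h : ((AddCircle.equivIco (1 : ℝ) 0 (v : UnitAddCircle) : Set.Ico (0 : ℝ) (0 + 1)) : ℝ)
      = Int.fract v := by
    simp [AddCircle.coe_equivIco_mk_apply (1 : ℝ) v]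
  unfold col
  rw [h, Int.natCast_floor_eq_floor (mul_nonneg (Nat.cast_nonneg _) (Int.fract_nonneg v))]
  rcases Nat.eq_zero_or_pos N with rfl | hN
  · simp
  have e : (N : ℝ) * Int.fract v = (N : ℝ) * v - ((N * ⌊v⌋ : ℤ) : ℝ) := by
    rw [Int.fract]; push_cast; ring
  have hN' : (0 : ℝ) < N := by exact_mod_cast hN
  have h0 : 0 ≤ ⌊(N : ℝ) * Int.fract v⌋ :=
    Int.floor_nonneg.2 (mul_nonneg hN'.le (Int.fract_nonneg v))
  have h1 : ⌊(N : ℝ) * Int.fract v⌋ < N := by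
    rw [Int.floor_lt]
    have := Int.fract_lt_one v
    push_cast
    nlinarith
  have h2 : ⌊(N : ℝ) * v⌋ = ⌊(N : ℝ) * Int.fract v⌋ + N * ⌊v⌋ := by
    rw [e, Int.floor_sub_intCast]; ring
  rw [h2, Int.add_mul_emod_self_left, Int.emod_eq_of_lt h0 h1]

theorem col_lt {N : ℕ} (hN : 0 < N) (u : UnitAddCircle) : col N u < N := by
  obtain ⟨v, rfl⟩ := exists_rep u
  have h := col_coe N v
  have : (0 : ℤ) < N := by exact_mod_cast hN
  have := Int.emod_lt_of_pos ⌊(N : ℝ) * v⌋ this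
  omega

theorem col_one (u : UnitAddCircle) : col 1 u = 0 := by
  have := col_lt one_pos u
  omega

theorem mem_arc_iff {N : ℕ} (hN : 0 < N) (i : ℕ) (u : UnitAddCircle) :
    u ∈ arc N i ↔ col N u = i % N := by
  have hN' : (0 : ℝ) < N := by exact_mod_cast hN
  constructor
  · rintro ⟨v, ⟨h1, h2⟩, rfl⟩
    have : ⌊(N : ℝ) * v⌋ = i := by
      rw [Int.floor_eq_iff]
      rw [div_le_iff₀ hN'] at h1
      rw [lt_div_iff₀ hN'] at h2
      push_cast
      constructor <;> linarith
    have h := col_coe N v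
    rw [this] at h
    exact_mod_cast h
  · intro h
    have hv : ((AddCircle.equivIco (1 : ℝ) 0 u : ℝ) : UnitAddCircle) = u :=
      AddCircle.coe_equivIco
    set v : ℝ := (AddCircle.equivIco (1 : ℝ) 0 u : ℝ)
    have hv0 : 0 ≤ v := (AddCircle.equivIco (1 : ℝ) 0 u).2.1
    have hc : ⌊(N : ℝ) * v⌋₊ = i % N := h
    rw [Nat.floor_eq_iff (mul_nonneg hN'.le hv0)] at hc
    have hi : (i : ℝ) = N * ((i / N : ℕ) : ℝ) + ((i % N : ℕ) : ℝ) := by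
      exact_mod_cast (Nat.div_add_mod i N).symm
    refine ⟨v + ((i / N : ℕ) : ℝ), ⟨?_, ?_⟩, ?_⟩
    · rw [div_le_iff₀ hN']; nlinarith
    · rw [lt_div_iff₀ hN']; nlinarith
    · change ((v + ((i / N : ℕ) : ℝ) : ℝ) : UnitAddCircle) = u
      rw [AddCircle.coe_add, hv]
      have : (((i / N : ℕ) : ℝ) : UnitAddCircle) = 0 := by
        rw [AddCircle.coe_eq_zero_iff]
        exact ⟨((i / N : ℕ) : ℤ), by rw [zsmul_eq_mul, Int.cast_natCast, mul_one]⟩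
      rw [this, add_zero]

theorem mem_arc_of_lt {N i : ℕ} (hi : i < N) (u : UnitAddCircle) :
    u ∈ arc N i ↔ col N u = i := by
  rw [mem_arc_iff (by omega), Nat.mod_eq_of_lt hi]

theorem col_mul (N M : ℕ) (hM : 0 < M) (u : UnitAddCircle) : col N u = col (N * M) u / M := by
  unfold col
  rw [← Nat.floor_div_natCast]
  congr 1
  have : (M : ℝ) ≠ 0 := by positivity
  push_cast
  field_simp

theorem measurable_col (N : ℕ) : Measurable (col N) := by
  have h : Measurable fun u => (AddCircle.equivIco (1 : ℝ) 0 u : ℝ) :=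
    measurable_subtype_coe.comp (AddCircle.measurableEquivIco (1 : ℝ) 0).measurable
  exact Nat.measurable_floor.comp (h.const_mul _)

theorem volume_col_le {N : ℕ} (hN : 0 < N) {i : ℕ} (hi : i < N) :
    volume {u | col N u = i} ≤ ENNReal.ofReal (1 / N) := by
  have hN' : (0 : ℝ) < N := by exact_mod_cast hN
  have hm : MeasurableSet {u | col N u = i} := measurable_col N (measurableSet_singleton i)
  -- This fundamental domain ends at the right endpoint of the arc, so the lift of the arc is not
  -- cut in two.
  have hp := UnitAddCircle.measurePreserving_mk (((i : ℝ) + 1) / N - 1)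
  rw [← hp.measure_preimage hm.nullMeasurableSet, Measure.restrict_apply (hp.measurable hm)]
  have e : ((i : ℝ) + 1) / N - i / N = 1 / N := by ring
  refine (measure_mono (t := Set.Icc ((i : ℝ) / N) (((i : ℝ) + 1) / N)) ?_).trans ?_
  · rintro v ⟨hv, hv1, hv2⟩
    rw [sub_add_cancel] at hv2
    refine ⟨?_, hv2⟩
    have hv' : (v : UnitAddCircle) ∈ arc N i := (mem_arc_of_lt hi _).2 hv
    obtain ⟨w, ⟨hw1, hw2⟩, hw⟩ := hv'
    change (w : UnitAddCircle) = (v : UnitAddCircle) at hw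
    rw [← sub_eq_zero, ← AddCircle.coe_sub, AddCircle.coe_eq_zero_iff] at hw
    obtain ⟨m, hm⟩ := hw
    simp only [zsmul_eq_mul, mul_one] at hm
    have h1 : (m : ℝ) < 1 := by linarith
    have h2 : m ≤ 0 := by
      have : m < 1 := by exact_mod_cast h1
      omega
    have h3 : (m : ℝ) ≤ 0 := by exact_mod_cast h2
    linarith
  · rw [Real.volume_Icc, e]

theorem norm_sub_le_of_col_eq {N : ℕ} (hN : 0 < N) {u v : UnitAddCircle} (h : col N u = col N v) :
    ‖u - v‖ ≤ 1 / N := by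
  have hN' : (0 : ℝ) < N := by exact_mod_cast hN
  obtain ⟨x, ⟨hx1, hx2⟩, rfl⟩ := (mem_arc_of_lt (col_lt hN u) u).2 rfl
  obtain ⟨y, ⟨hy1, hy2⟩, rfl⟩ := (mem_arc_of_lt (col_lt hN v) v).2 rfl
  change ‖((x : ℝ) : UnitAddCircle) - ((y : ℝ) : UnitAddCircle)‖ ≤ 1 / N
  change col N (x : UnitAddCircle) = col N (y : UnitAddCircle) at h
  change (col N (x : UnitAddCircle) : ℝ) / N ≤ x at hx1
  change x < ((col N (x : UnitAddCircle) : ℝ) + 1) / N at hx2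
  change (col N (y : UnitAddCircle) : ℝ) / N ≤ y at hy1
  change y < ((col N (y : UnitAddCircle) : ℝ) + 1) / N at hy2
  rw [h] at hx1 hx2
  rw [← AddCircle.coe_sub]
  have e : ((col N (y : UnitAddCircle) : ℝ) + 1) / N = (col N (y : UnitAddCircle) : ℝ) / N + 1 / N := by
    ring
  refine QuotientAddGroup.norm_mk_le_norm.trans ?_
  rw [Real.norm_eq_abs, abs_le]
  constructor <;> linarith

/-! ### Arithmetic of the parameters and of the times -/

namespace AbC

variable (D : AbC)

theorem q_pos (n : ℕ) : 0 < D.q n := by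
  induction n with
  | zero => rw [D.q_zero]; exact one_pos
  | succ n ih =>
    rw [D.q_succ]
    have := D.k_pos n
    have := D.l_pos n
    positivity

theorem two_pow_le_q (hl : ∀ n, 2 ≤ D.l n) (n : ℕ) : 2 ^ n ≤ D.q n := by
  induction n with
  | zero => rw [D.q_zero]; simp
  | succ n ih =>
    rw [D.q_succ, pow_succ]
    have h1 := D.k_pos n
    have h2 := hl n
    have h3 := D.q_pos n
    calc 2 ^ n * 2 ≤ D.q n * 2 := by gcongr
      _ ≤ D.q n * (D.k n * D.l n * D.q n) := by
        gcongr
        nlinarith [Nat.mul_le_mul h1 h2, Nat.mul_le_mul (Nat.mul_le_mul h1 h2) h3]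
      _ = _ := by ring

/-- `p_{n+1}` is 1 modulo `q_n k_n l_n`, which contains every prime factor of `q_{n+1}`. -/
theorem coprime_p_q (n : ℕ) : (D.p n).Coprime (D.q n) := by
  cases n with
  | zero => rw [D.q_zero]; exact Nat.coprime_one_right _
  | succ n =>
    have h : (D.p (n + 1)).Coprime (D.q n * (D.k n * D.l n)) := by
      rw [D.p_succ]
      have e : D.p n * D.q n * D.k n * D.l n + 1
          = 1 + D.p n * (D.q n * (D.k n * D.l n)) := by ring
      rw [e]
      exact (Nat.coprime_add_mul_right_left 1 _ _).2 (Nat.coprime_one_left _)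
    have h' : (D.p (n + 1)).Coprime (D.q n) := Nat.Coprime.coprime_mul_right_right h
    have e : D.q (n + 1) = D.q n * (D.k n * D.l n) * D.q n := by rw [D.q_succ]; ring
    rw [e]
    exact Nat.Coprime.mul_right h h'

/-- The residue `d < q_n` with `p_n d ≡ i mod q_n`. -/
noncomputable def back (n i : ℕ) : ℕ :=
  ((D.p n : ZMod (D.q n))⁻¹ * (i : ZMod (D.q n))).val

theorem back_lt (n i : ℕ) : D.back n i < D.q n := by
  have : NeZero (D.q n) := ⟨(D.q_pos n).ne'⟩
  exact ZMod.val_lt _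

theorem p_mul_back (n i : ℕ) : D.p n * D.back n i ≡ i [MOD D.q n] := by
  have : NeZero (D.q n) := ⟨(D.q_pos n).ne'⟩
  rw [← ZMod.natCast_eq_natCast_iff, back]
  push_cast
  rw [ZMod.natCast_val, ZMod.cast_id, ← mul_assoc, ZMod.coe_mul_inv_eq_one _ (D.coprime_p_q n),
    one_mul]

theorem eq_of_p_mul_modEq {n d d' : ℕ} (hd : d < D.q n) (hd' : d' < D.q n)
    (h : D.p n * d ≡ D.p n * d' [MOD D.q n]) : d = d' :=
  (Nat.ModEq.cancel_left_of_coprime (D.coprime_p_q n).symm h).eq_of_lt_of_lt hd hd'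

theorem eq_back {n d i : ℕ} (hd : d < D.q n) (h : D.p n * d ≡ i [MOD D.q n]) : d = D.back n i :=
  D.eq_of_p_mul_modEq hd (D.back_lt n i) (h.trans (D.p_mul_back n i).symm)

theorem back_zero (n : ℕ) : D.back n 0 = 0 :=
  (D.eq_back (D.q_pos n) (by rw [mul_zero])).symm

/-- This makes the section `i = 0`, and so the beginning of a circular word, recognizable. -/
theorem eq_zero_of_back_eq_zero {n i : ℕ} (hi : i < D.q n) (h : D.back n i = 0) : i = 0 := by
  have := D.p_mul_back n i
  rw [h, mul_zero] at this
  exact (this.eq_of_lt_of_lt (D.q_pos n) hi).symm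

/-- The length `l_n q_n` of the words `b^{q_n - d_i} w_j^{l_n - 1} e^{d_i}`. -/
def runLen (n : ℕ) : ℕ := D.l n * D.q n

theorem runLen_pos (n : ℕ) : 0 < D.runLen n := Nat.mul_pos (D.l_pos n) (D.q_pos n)

theorem two_mul_q_le_runLen (hl : ∀ n, 2 ≤ D.l n) (n : ℕ) : 2 * D.q n ≤ D.runLen n :=
  Nat.mul_le_mul_right _ (hl n)

theorem q_succ_eq (n : ℕ) : D.q (n + 1) = D.k n * D.q n * D.runLen n := by
  rw [D.q_succ, runLen]; ring

theorem div_runLen_lt {n t : ℕ} (ht : t < D.q (n + 1)) : t / D.runLen n < D.k n * D.q n := by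
  rw [Nat.div_lt_iff_lt_mul (D.runLen_pos n), ← D.q_succ_eq]
  exact ht

theorem div_runLen_div_lt {n t : ℕ} (ht : t < D.q (n + 1)) :
    t / D.runLen n / D.k n < D.q n := by
  rw [Nat.div_lt_iff_lt_mul (D.k_pos n), mul_comm]
  exact D.div_runLen_lt ht

/-- The number `d_i` that belongs to the time `t`. -/
noncomputable def shiftAt (n t : ℕ) : ℕ := D.back n (t / D.runLen n / D.k n)

theorem shiftAt_lt (n t : ℕ) : D.shiftAt n t < D.q n := D.back_lt _ _

theorem exists_decomposition {n t : ℕ} (ht : t < D.q (n + 1)) :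
    ∃ i j r : ℕ, i < D.q n ∧ j < D.k n ∧ r < D.l n * D.q n ∧
      t = i * (D.k n * D.l n * D.q n) + j * (D.l n * D.q n) + r ∧
      i = t / D.runLen n / D.k n ∧ r = t % D.runLen n := by
  refine ⟨_, t / D.runLen n % D.k n, _, D.div_runLen_div_lt ht, Nat.mod_lt _ (D.k_pos n),
    Nat.mod_lt _ (D.runLen_pos n), ?_, rfl, rfl⟩
  have h1 := Nat.div_add_mod t (D.runLen n)
  have h2 := Nat.div_add_mod (t / D.runLen n) (D.k n)
  change t = t / D.runLen n / D.k n * (D.k n * D.l n * D.q n)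
    + t / D.runLen n % D.k n * D.runLen n + t % D.runLen n
  generalize t / D.runLen n = g at *
  generalize t % D.runLen n = r at *
  have e : D.runLen n * g = D.runLen n * (D.k n * (g / D.k n) + g % D.k n) := by rw [h2]
  have e' : D.k n * D.l n * D.q n = D.k n * D.runLen n := mul_assoc _ _ _
  rw [e', ← h1, e]
  ring

theorem decomposition_unique {n t i j r : ℕ} (hj : j < D.k n)
    (hr : r < D.l n * D.q n)
    (ht : t = i * (D.k n * D.l n * D.q n) + j * (D.l n * D.q n) + r) :
    i = t / D.runLen n / D.k n ∧ r = t % D.runLen n := by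
  have e : t = r + D.runLen n * (j + D.k n * i) := by rw [ht, runLen]; ring
  replace hr : r < D.runLen n := hr
  have h1 : t % D.runLen n = r := by
    rw [e, Nat.add_mul_mod_self_left, Nat.mod_eq_of_lt hr]
  have h2 : t / D.runLen n = j + D.k n * i := by
    rw [e, Nat.add_mul_div_left _ _ (D.runLen_pos n), Nat.div_eq_of_lt hr, zero_add]
  rw [h1, h2, Nat.add_mul_div_left _ _ (D.k_pos n), Nat.div_eq_of_lt hj, zero_add]
  exact ⟨rfl, rfl⟩

theorem time_lt {n t i j r : ℕ} (hi : i < D.q n) (hj : j < D.k n) (hr : r < D.l n * D.q n)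
    (ht : t = i * (D.k n * D.l n * D.q n) + j * (D.l n * D.q n) + r) : t < D.q (n + 1) := by
  have h1 : i * D.k n + j + 1 ≤ D.k n * D.q n := by nlinarith [Nat.mul_le_mul_right (D.k n) hi]
  rw [D.q_succ_eq, runLen]
  calc t < (i * D.k n + j + 1) * (D.l n * D.q n) := by rw [ht]; linarith
    _ ≤ _ := Nat.mul_le_mul_right _ h1

theorem isBTime_iff {n t : ℕ} :
    D.IsBTime n t ↔ t < D.q (n + 1) ∧ t % D.runLen n < D.q n - D.shiftAt n t := by
  constructor
  · rintro ⟨i, j, r, d, hi, hj, hr, ht, hd, hpd, h⟩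
    obtain ⟨rfl, rfl⟩ := D.decomposition_unique hj hr ht
    obtain rfl := D.eq_back hd hpd
    exact ⟨D.time_lt hi hj hr ht, h⟩
  · rintro ⟨ht, h⟩
    obtain ⟨i, j, r, hi, hj, hr, ht, rfl, rfl⟩ := D.exists_decomposition ht
    exact ⟨_, j, _, _, hi, hj, hr, ht, D.back_lt _ _, D.p_mul_back _ _, h⟩

theorem isETime_iff {n t : ℕ} :
    D.IsETime n t ↔ t < D.q (n + 1) ∧ D.runLen n - D.shiftAt n t ≤ t % D.runLen n := by
  constructor
  · rintro ⟨i, j, r, d, hi, hj, hr, ht, hd, hpd, h⟩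
    obtain ⟨rfl, rfl⟩ := D.decomposition_unique hj hr ht
    obtain rfl := D.eq_back hd hpd
    exact ⟨D.time_lt hi hj hr ht, h⟩
  · rintro ⟨ht, h⟩
    obtain ⟨i, j, r, hi, hj, hr, ht, rfl, rfl⟩ := D.exists_decomposition ht
    exact ⟨_, j, _, _, hi, hj, hr, ht, D.back_lt _ _, D.p_mul_back _ _, h⟩

/-! ### Levels and rows: from stage `n + 1` to stage `n` -/

/-- The index `j` of the subword `w_j` that is read at time `t`. -/
def wordIndex (n t : ℕ) : ℕ := t / D.runLen n % D.k n

theorem wordIndex_lt (n t : ℕ) : D.wordIndex n t < D.k n := Nat.mod_lt _ (D.k_pos n)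

/-- The level of the tower of stage `n` that contains the levels `t` of stage `n + 1`. -/
noncomputable def proj (n t : ℕ) : ℕ := (t % D.runLen n + D.shiftAt n t) % D.q n

/-- The index `t` of the level `(R^{α_n})^t ([0, 1/q_n) × 𝕋)` that contains `z`. -/
noncomputable def pos (n : ℕ) (z : Torus) : ℕ := D.back n (col (D.q n) z.1)

/-- The index of the row `𝕋 × [j/s_n, (j+1)/s_n)` that contains `z`. -/
noncomputable def row (n : ℕ) (z : Torus) : ℕ := col (D.s n) z.2

theorem pos_lt (n : ℕ) (z : Torus) : D.pos n z < D.q n := D.back_lt _ _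

theorem row_lt (n : ℕ) (z : Torus) : D.row n z < D.s n := col_lt (D.s_pos n) _

theorem mem_column_iff {n t : ℕ} (ht : t < D.q n) (z : Torus) :
    z ∈ column (D.q n) (D.p n * t) ↔ D.pos n z = t := by
  simp only [column, Set.mem_prod, Set.mem_univ, and_true]
  rw [mem_arc_iff (D.q_pos n), pos]
  constructor
  · intro h
    rw [h]
    exact (D.eq_back ht (Nat.mod_modEq _ _).symm).symm
  · rintro rfl
    exact (Nat.mod_eq_of_lt (col_lt (D.q_pos n) z.1)).symm.trans (D.p_mul_back _ _).symm

theorem col_eq_of_pos_eq {n : ℕ} {z z' : Torus} (h : D.pos n z = D.pos n z') :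
    col (D.q n) z.1 = col (D.q n) z'.1 := by
  have h1 := D.p_mul_back n (col (D.q n) z.1)
  have h2 := D.p_mul_back n (col (D.q n) z'.1)
  unfold pos at h
  rw [h] at h1
  exact (h1.symm.trans h2).eq_of_lt_of_lt (col_lt (D.q_pos n) _) (col_lt (D.q_pos n) _)

theorem mem_stageB_iff {n : ℕ} {z : Torus} :
    z ∈ D.stageB (n + 1) ↔ D.IsBTime n (D.pos (n + 1) z) := by
  constructor
  · rintro ⟨t, ht, hz⟩
    rw [D.mem_column_iff (D.isBTime_iff.1 ht).1] at hz
    rwa [hz]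
  · intro h
    exact ⟨_, h, (D.mem_column_iff (D.pos_lt _ _) z).2 rfl⟩

theorem mem_stageE_iff {n : ℕ} {z : Torus} :
    z ∈ D.stageE (n + 1) ↔ D.IsETime n (D.pos (n + 1) z) := by
  constructor
  · rintro ⟨t, ht, hz⟩
    rw [D.mem_column_iff (D.isETime_iff.1 ht).1] at hz
    rwa [hz]
  · intro h
    exact ⟨_, h, (D.mem_column_iff (D.pos_lt _ _) z).2 rfl⟩

/-- As `p_{n+1} = 1 + p_n k_n (l_n q_n)`, the column index `p_{n+1} t` is `t` plus a multiple of the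
run length; dividing by the run length passes to the coarser grid. -/
theorem col_runs (n : ℕ) (z : Torus) :
    col (D.k n * D.q n) z.1 = (D.p n * D.k n * D.pos (n + 1) z
      + D.pos (n + 1) z / D.runLen n) % (D.k n * D.q n) := by
  set t := D.pos (n + 1) z
  have h : col (D.q (n + 1)) z.1 = (D.p (n + 1) * t) % D.q (n + 1) := by
    rw [← Nat.mod_eq_of_lt (col_lt (D.q_pos (n + 1)) z.1)]
    exact (D.p_mul_back _ _).symm
  rw [col_mul _ (D.runLen n) (D.runLen_pos n), ← D.q_succ_eq, h, D.q_succ_eq,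
    Nat.mod_mul_left_div_self]
  have e : D.p (n + 1) * t = t + D.runLen n * (D.p n * D.k n * t) := by
    rw [D.p_succ, runLen]; ring
  rw [e, Nat.add_mul_div_left _ _ (D.runLen_pos n), add_comm]

theorem col_q (n : ℕ) (z : Torus) :
    col (D.q n) z.1 = col (D.k n * D.q n) z.1 / D.k n := by
  rw [mul_comm, ← col_mul _ _ (D.k_pos n)]

theorem col_runs_mod (n : ℕ) (z : Torus) :
    col (D.k n * D.q n) z.1 % D.k n = D.wordIndex n (D.pos (n + 1) z) := by
  rw [D.col_runs, Nat.mod_mul_right_mod, wordIndex]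
  have e : D.p n * D.k n * D.pos (n + 1) z + D.pos (n + 1) z / D.runLen n
      = D.pos (n + 1) z / D.runLen n + D.k n * (D.p n * D.pos (n + 1) z) := by ring
  rw [e, Nat.add_mul_mod_self_left]

/-- Modulo `q_n` the column is `p_n t + i ≡ p_n (t + d_i)`, where `i` is the section of `t`; the run
length is a multiple of `q_n`, so only the remainder of `t` matters. -/
theorem back_col (n : ℕ) (z : Torus) :
    D.back n (col (D.q n) z.1) = D.proj n (D.pos (n + 1) z) := by
  symm
  apply D.eq_back (Nat.mod_lt _ (D.q_pos n))
  set t := D.pos (n + 1) z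
  have h : col (D.q n) z.1 = (D.p n * t + t / D.runLen n / D.k n) % D.q n := by
    rw [D.col_q, D.col_runs, Nat.mod_mul_right_div_self]
    have e : D.p n * D.k n * t + t / D.runLen n = t / D.runLen n + D.k n * (D.p n * t) := by ring
    rw [e, Nat.add_mul_div_left _ _ (D.k_pos n), add_comm]
  rw [h]
  have h1 : t % D.runLen n ≡ t [MOD D.q n] :=
    (Nat.mod_modEq t (D.runLen n)).of_dvd (Dvd.intro_left _ rfl)
  refine Nat.ModEq.trans ?_ (Nat.mod_modEq _ _).symm
  refine ((Nat.mod_modEq _ _).mul_left _).trans ?_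
  rw [mul_add]
  exact (h1.mul_left _).add (D.p_mul_back _ _)

theorem col_h (n : ℕ) (z : Torus) :
    col (D.q n) (D.h (n + 1) z).1 = col (D.q n) z.1 := by
  have hc := col_lt (D.q_pos n) z.1
  have h : D.h (n + 1) z ∈ column (D.q n) (col (D.q n) z.1) := by
    rw [← D.h_untwisted n _ hc]
    exact Set.mem_image_of_mem _ ⟨(mem_arc_of_lt hc _).2 rfl, trivial⟩
  exact (mem_arc_of_lt hc _).1 h.1

theorem pos_h (n : ℕ) (z : Torus) :
    D.pos n (D.h (n + 1) z) = D.proj n (D.pos (n + 1) z) := by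
  rw [pos, D.col_h, D.back_col]

theorem h_rot (n m : ℕ) (z : Torus) :
    D.h (n + 1) (rot ((m : ℝ) / D.q n) z) = rot ((m : ℝ) / D.q n) (D.h (n + 1) z) := by
  induction m generalizing z with
  | zero => simp [rot]
  | succ m ih =>
    have e : ∀ w : Torus, rot (((m + 1 : ℕ) : ℝ) / D.q n) w
        = rot ((m : ℝ) / D.q n) (rot (1 / (D.q n : ℝ)) w) := by
      intro w
      simp only [rot, add_assoc, ← AddCircle.coe_add]
      congr 3
      push_cast
      ring
    rw [e, e, ih, D.h_comm]

theorem rect_nonempty {N M : ℕ} (hN : 0 < N) (hM : 0 < M) (i j : ℕ) : (rect N M i j).Nonempty := by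
  have key : ∀ {N : ℕ} (_ : 0 < N) (i : ℕ), (arc N i).Nonempty := fun {N} h i =>
    ⟨((i / N : ℝ) : UnitAddCircle), _, ⟨le_rfl, by gcongr; linarith⟩, rfl⟩
  exact (key hN i).prod (key hM j)

theorem Sends.unique {D : AbC} {n r t j j' : ℕ} (h : D.Sends n r t j) (h' : D.Sends n r t j')
    (hj : j < D.s n) (hj' : j' < D.s n) : j = j' := by
  obtain ⟨x, hx⟩ := rect_nonempty (Nat.mul_pos (D.k_pos n) (D.q_pos n)) (D.s_pos (n + 1)) t r
  have h1 := (h (Set.mem_image_of_mem _ hx)).2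
  have h2 := (h' (Set.mem_image_of_mem _ hx)).2
  rw [mem_arc_of_lt hj] at h1
  rw [mem_arc_of_lt hj'] at h2
  omega

/-- The index sets for the `s_n` values of `j` are disjoint and have `k_n / s_n` elements each, so
they exhaust all `t < k_n`. -/
theorem exists_sends (h2 : D.Requirement2) {n r t : ℕ} (hr : r < D.s (n + 1)) (ht : t < D.k n) :
    ∃ j < D.s n, D.Sends n r t j := by
  classical
  let S : ℕ → Finset ℕ := fun j => (Finset.range (D.k n)).filter fun t => D.Sends n r t j
  have hS : ∀ j ∈ Finset.range (D.s n), ((S j).card : ℚ) = (D.k n : ℚ) / D.s n := by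
    intro j hj
    rw [← h2 n r hr j (Finset.mem_range.1 hj), ← Set.ncard_coe_finset]
    congr 2
    ext t
    simp [S]
  have hd : Set.PairwiseDisjoint (Finset.range (D.s n) : Set ℕ) S := by
    intro j hj j' hj' hne
    rw [Function.onFun, Finset.disjoint_left]
    intro t ht ht'
    rw [Finset.mem_filter] at ht ht'
    exact hne (ht.2.unique ht'.2 (Finset.mem_range.1 hj) (Finset.mem_range.1 hj'))
  have hc : ((Finset.range (D.s n)).biUnion S).card = D.k n := by
    have : (D.s n : ℚ) ≠ 0 := by exact_mod_cast (D.s_pos n).ne'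
    rw [Finset.card_biUnion hd]
    have h : ((∑ j ∈ Finset.range (D.s n), (S j).card : ℕ) : ℚ) = D.k n := by
      push_cast
      rw [Finset.sum_congr rfl hS, Finset.sum_const, Finset.card_range, nsmul_eq_mul]
      field_simp
    exact_mod_cast h
  have hsub : (Finset.range (D.s n)).biUnion S ⊆ Finset.range (D.k n) :=
    Finset.biUnion_subset.2 fun j _ => Finset.filter_subset _ _
  have heq := Finset.eq_of_subset_of_card_le hsub (by rw [hc, Finset.card_range])
  have : t ∈ (Finset.range (D.s n)).biUnion S := by rw [heq]; exact Finset.mem_range.2 ht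
  rw [Finset.mem_biUnion] at this
  obtain ⟨j, hj, hjt⟩ := this
  exact ⟨j, Finset.mem_range.1 hj, (Finset.mem_filter.1 hjt).2⟩

/-- `h_{n+1}` commutes with `R^{1/q_n}`, so `z` may be rotated back to the column `[0, 1/q_n)`,
which is the one `Sends` speaks of; no row changes. -/
theorem sends_row (h2 : D.Requirement2) (n : ℕ) (z : Torus) :
    D.Sends n (D.row (n + 1) z) (D.wordIndex n (D.pos (n + 1) z)) (D.row n (D.h (n + 1) z)) := by
  set J := D.wordIndex n (D.pos (n + 1) z)
  have hkq : 0 < D.k n * D.q n := Nat.mul_pos (D.k_pos n) (D.q_pos n)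
  set C := col (D.q n) z.1
  have hC : col (D.k n * D.q n) z.1 = C * D.k n + J := by
    have := Nat.div_add_mod (col (D.k n * D.q n) z.1) (D.k n)
    rw [← D.col_q, D.col_runs_mod] at this
    rw [← this, mul_comm]
  obtain ⟨j, hj, hs⟩ := D.exists_sends h2 (D.row_lt (n + 1) z)
    (D.wordIndex_lt n (D.pos (n + 1) z))
  suffices hrow : D.row n (D.h (n + 1) z) = j by rw [hrow]; exact hs
  have hk0 : (D.k n : ℝ) ≠ 0 := by exact_mod_cast (D.k_pos n).ne'
  have hq0 : (D.q n : ℝ) ≠ 0 := by exact_mod_cast (D.q_pos n).ne'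
  obtain ⟨v, ⟨hv1, hv2⟩, hv⟩ := (mem_arc_of_lt (col_lt hkq z.1) z.1).2 rfl
  rw [hC] at hv1 hv2
  have e1 : (((C * D.k n + J : ℕ) : ℝ)) / ((D.k n * D.q n : ℕ) : ℝ)
      = (J : ℝ) / ((D.k n * D.q n : ℕ) : ℝ) + C / D.q n := by
    push_cast; field_simp; ring
  have e2 : (((C * D.k n + J : ℕ) : ℝ) + 1) / ((D.k n * D.q n : ℕ) : ℝ)
      = ((J : ℝ) + 1) / ((D.k n * D.q n : ℕ) : ℝ) + C / D.q n := by
    push_cast; field_simp; ring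
  rw [e1] at hv1
  rw [e2] at hv2
  let y : Torus := (((v - C / D.q n : ℝ) : UnitAddCircle), z.2)
  have hy : rot ((C : ℝ) / D.q n) y = z := by
    simp only [rot, y, ← AddCircle.coe_add, sub_add_cancel]
    exact Prod.ext hv rfl
  have hymem : y ∈ rect (D.k n * D.q n) (D.s (n + 1)) J (D.row (n + 1) z) :=
    ⟨⟨_, ⟨by linarith, by linarith⟩, rfl⟩, (mem_arc_of_lt (D.row_lt (n + 1) z) _).2 rfl⟩
  have hyj := (hs (Set.mem_image_of_mem _ hymem)).2
  rw [mem_arc_of_lt hj] at hyj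
  rw [← hy, D.h_rot]
  exact hyj

/-! ### Levels and rows at all stages separate points -/

theorem H_symm_succ (n : ℕ) (x : Torus) :
    D.h (n + 1) ((D.H (n + 1)).symm x) = (D.H n).symm x := by
  change D.h (n + 1) ((D.h (n + 1)).symm ((D.H n).symm x)) = _
  exact (D.h (n + 1)).apply_symm_apply _

theorem h_sub_h {n : ℕ} {z z' : Torus}
    (h1 : col (D.k n * D.q n) z.1 = col (D.k n * D.q n) z'.1)
    (h2 : D.row (n + 1) z = D.row (n + 1) z') :
    D.h (n + 1) z - D.h (n + 1) z' = z - z' := by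
  have hkq : 0 < D.k n * D.q n := Nat.mul_pos (D.k_pos n) (D.q_pos n)
  obtain ⟨i', -, j', -, h⟩ := D.h_perm n _ (col_lt hkq z'.1) _ (D.row_lt (n + 1) z')
  have hz := h z ⟨(mem_arc_of_lt (col_lt hkq z'.1) _).2 h1,
    (mem_arc_of_lt (D.row_lt (n + 1) z') _).2 h2⟩
  have hz' := h z' ⟨(mem_arc_of_lt (col_lt hkq z'.1) _).2 rfl,
    (mem_arc_of_lt (D.row_lt (n + 1) z') _).2 rfl⟩
  rw [hz, hz']
  ext <;> simp

/-- Equality of level and row descends to all lower stages, so each of `h_n, …, h_1` in turn moves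
both points by the same translation. -/
theorem H_zero_symm_sub (h2 : D.Requirement2) {n : ℕ} {x y : Torus}
    (hp : D.pos n ((D.H n).symm x) = D.pos n ((D.H n).symm y))
    (hr : D.row n ((D.H n).symm x) = D.row n ((D.H n).symm y)) :
    (D.H 0).symm x - (D.H 0).symm y = (D.H n).symm x - (D.H n).symm y := by
  induction n with
  | zero => rfl
  | succ n ih =>
    have hp' : D.pos n ((D.H n).symm x) = D.pos n ((D.H n).symm y) := by
      rw [← D.H_symm_succ n x, ← D.H_symm_succ n y, D.pos_h, D.pos_h, hp]
    have hr' : D.row n ((D.H n).symm x) = D.row n ((D.H n).symm y) := by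
      have hx := D.sends_row h2 n ((D.H (n + 1)).symm x)
      have hy := D.sends_row h2 n ((D.H (n + 1)).symm y)
      rw [D.H_symm_succ] at hx hy
      rw [hp, hr] at hx
      exact hx.unique hy (D.row_lt _ _) (D.row_lt _ _)
    rw [ih hp' hr', ← D.H_symm_succ n x, ← D.H_symm_succ n y]
    refine D.h_sub_h ?_ hr
    rw [D.col_runs, D.col_runs, hp]

theorem eq_of_forall_pos_row (hl : ∀ n, 2 ≤ D.l n) (h1 : D.Requirement1) (h2 : D.Requirement2)
    {x y : Torus}
    (h : ∀ᶠ n in atTop, D.pos n ((D.H n).symm x) = D.pos n ((D.H n).symm y) ∧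
      D.row n ((D.H n).symm x) = D.row n ((D.H n).symm y)) : x = y := by
  have hq : Tendsto D.q atTop atTop :=
    tendsto_atTop_mono (D.two_pow_le_q hl) (tendsto_pow_atTop_atTop_of_one_lt (by norm_num))
  have hq' : Tendsto (fun n => 1 / (D.q n : ℝ)) atTop (𝓝 0) :=
    tendsto_one_div_atTop_nhds_zero_nat.comp hq
  have hs' : Tendsto (fun n => 1 / (D.s n : ℝ)) atTop (𝓝 0) :=
    tendsto_one_div_atTop_nhds_zero_nat.comp h1
  have e1 : ((D.H 0).symm x - (D.H 0).symm y).1 = 0 := by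
    rw [← norm_le_zero_iff]
    refine ge_of_tendsto hq' ?_
    filter_upwards [h] with n hn
    rw [D.H_zero_symm_sub h2 hn.1 hn.2]
    exact norm_sub_le_of_col_eq (D.q_pos n) (D.col_eq_of_pos_eq hn.1)
  have e2 : ((D.H 0).symm x - (D.H 0).symm y).2 = 0 := by
    rw [← norm_le_zero_iff]
    refine ge_of_tendsto hs' ?_
    filter_upwards [h] with n hn
    rw [D.H_zero_symm_sub h2 hn.1 hn.2]
    exact norm_sub_le_of_col_eq (D.s_pos n) hn.2
  have e : (D.H 0).symm x - (D.H 0).symm y = 0 := Prod.ext e1 e2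
  exact (D.H 0).symm.injective (sub_eq_zero.1 e)

end AbC

/-! ### Plain times inside a circular word -/

namespace AbC

section Times

variable (D : AbC)

/-- The time `t` carries no inserted letter. -/
def IsPlain (n t : ℕ) : Prop :=
  D.q n ≤ t % D.runLen n + D.shiftAt n t ∧ t % D.runLen n + D.shiftAt n t < D.runLen n

variable {D} {n t : ℕ}

theorem isPlain_iff (ht : t < D.q (n + 1)) :
    D.IsPlain n t ↔ ¬ D.IsBTime n t ∧ ¬ D.IsETime n t := by
  rw [isBTime_iff, isETime_iff, IsPlain]
  have := D.shiftAt_lt n t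
  have := Nat.mod_lt t (D.runLen_pos n)
  have := Nat.le_mul_of_pos_left (D.q n) (D.l_pos n)
  have : D.q n ≤ D.runLen n := this
  omega

theorem not_isBTime_and_isETime (hl : ∀ n, 2 ≤ D.l n) : ¬ (D.IsBTime n t ∧ D.IsETime n t) := by
  rw [isBTime_iff, isETime_iff]
  have := D.two_mul_q_le_runLen hl n
  have := D.shiftAt_lt n t
  omega

theorem div_mod_of_eq {g r : ℕ} (hr : r < D.runLen n) (ht : t = g * D.runLen n + r) :
    t / D.runLen n = g ∧ t % D.runLen n = r := by
  have e : t = r + D.runLen n * g := by rw [ht]; ring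
  rw [e, Nat.add_mul_mod_self_left, Nat.add_mul_div_left _ _ (D.runLen_pos n),
    Nat.div_eq_of_lt hr, Nat.mod_eq_of_lt hr, zero_add]
  exact ⟨rfl, rfl⟩

theorem succ_div_mod (h : t % D.runLen n + 1 < D.runLen n) :
    (t + 1) / D.runLen n = t / D.runLen n ∧ (t + 1) % D.runLen n = t % D.runLen n + 1 :=
  div_mod_of_eq h (by rw [mul_comm, ← add_assoc, Nat.div_add_mod])

theorem shiftAt_eq_zero (h : t / D.runLen n < D.k n) : D.shiftAt n t = 0 := by
  rw [shiftAt, Nat.div_eq_of_lt h, D.back_zero]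

theorem div_lt_of_shiftAt_eq_zero (ht : t < D.q (n + 1)) (h : D.shiftAt n t = 0) :
    t / D.runLen n < D.k n := by
  have := D.eq_zero_of_back_eq_zero (D.div_runLen_div_lt ht) h
  exact (Nat.div_eq_zero_iff.1 this).resolve_left (D.k_pos n).ne'

theorem mul_runLen_add_lt {g r : ℕ} (hg : g < D.k n) (hr : r < D.runLen n) :
    g * D.runLen n + r < D.q (n + 1) := by
  rw [D.q_succ_eq]
  calc g * D.runLen n + r < (g + 1) * D.runLen n := by linarith
    _ ≤ _ := Nat.mul_le_mul_right _ (hg.trans_le (Nat.le_mul_of_pos_right _ (D.q_pos n)))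

theorem IsPlain.pos (h : D.IsPlain n t) : 0 < t := by
  rw [Nat.pos_iff_ne_zero]
  rintro rfl
  have h0 : D.shiftAt n 0 = 0 := shiftAt_eq_zero (by rw [Nat.zero_div]; exact D.k_pos n)
  have := h.1
  rw [h0, Nat.zero_mod] at this
  exact absurd (D.q_pos n) (by omega)

/-- The plain stretch of a run is `q_n ≤ r + d_i < l_n q_n`. Its upper bound is a multiple of `q_n`,
so it can be left only from level `q_n - 1`. -/
theorem IsPlain.succ (h : D.IsPlain n t) (hlt : D.proj n t + 1 < D.q n) :
    t % D.runLen n + 1 < D.runLen n ∧ D.IsPlain n (t + 1) ∧ D.proj n (t + 1) = D.proj n t + 1 := by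
  have hne : t % D.runLen n + D.shiftAt n t + 1 ≠ D.runLen n := by
    intro he
    have h0 : (t % D.runLen n + D.shiftAt n t + 1) % D.q n = 0 := by
      rw [he, runLen, Nat.mul_mod_left]
    have h1 : (t % D.runLen n + D.shiftAt n t + 1) % D.q n = D.proj n t + 1 := by
      rw [Nat.add_mod, ← proj, Nat.add_mod_mod, Nat.mod_eq_of_lt hlt]
    omega
  have h1 : t % D.runLen n + 1 < D.runLen n := by have := h.2; omega
  obtain ⟨hd, hm⟩ := succ_div_mod h1
  have hs : D.shiftAt n (t + 1) = D.shiftAt n t := by rw [shiftAt, hd, shiftAt]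
  refine ⟨h1, ?_, ?_⟩
  · rw [IsPlain, hs, hm]
    have := h.1
    have := h.2
    omega
  · rw [proj, hs, hm, add_right_comm, Nat.add_mod, ← proj, Nat.add_mod_mod, Nat.mod_eq_of_lt hlt]

/-- Every run starts with at least one `b`, since `d_i < q_n`; hence a plain time is never the first
of its run. -/
theorem IsPlain.pred (h : D.IsPlain n (t + 1))
    (hlt : t % D.runLen n + 1 < D.runLen n → D.q n < (t + 1) % D.runLen n + D.shiftAt n (t + 1)) :
    t % D.runLen n + 1 < D.runLen n ∧ D.IsPlain n t := by
  have h1 : t % D.runLen n + 1 < D.runLen n := by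
    by_contra hc
    have hr := Nat.mod_lt t (D.runLen_pos n)
    have he : t % D.runLen n + 1 = D.runLen n := by omega
    have ht := Nat.div_add_mod t (D.runLen n)
    have := div_mod_of_eq (n := n) (t := t + 1) (g := t / D.runLen n + 1) (D.runLen_pos n)
      (by rw [add_mul, mul_comm, one_mul, add_zero]; omega)
    have h2 := h.1
    rw [this.2] at h2
    have := D.shiftAt_lt n (t + 1)
    omega
  obtain ⟨hd, hm⟩ := succ_div_mod h1
  have hs : D.shiftAt n (t + 1) = D.shiftAt n t := by rw [shiftAt, hd, shiftAt]
  have h2 := hlt h1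
  have h3 := h.2
  rw [hm, hs] at h2 h3
  exact ⟨h1, by omega, by omega⟩

theorem wordIndex_succ (h : t % D.runLen n + 1 < D.runLen n) :
    D.wordIndex n (t + 1) = D.wordIndex n t := by
  rw [wordIndex, (succ_div_mod h).1, wordIndex]

theorem succ_lt_q_succ (ht : t < D.q (n + 1)) (h : t % D.runLen n + 1 < D.runLen n) :
    t + 1 < D.q (n + 1) := by
  have h1 := D.div_runLen_lt ht
  rw [D.q_succ_eq, ← Nat.div_lt_iff_lt_mul (D.runLen_pos n), (succ_div_mod h).1]
  exact h1

end Times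

/-! ### Codings of orbits and unique readability -/

variable (D : AbC)

/-- The index `i` of the coded orbit receives no inserted letter at stages later than `n`. -/
def InWord (P : ℕ → ℤ → ℕ) (n : ℕ) (i : ℤ) : Prop := ∀ m, n ≤ m → D.IsPlain m (P (m + 1) i)

/-- The combinatorial data of an orbit: `P n i` is the level and `R n i` the row of the `i`-th
point of the orbit with respect to the tower of stage `n`. -/
structure IsCoding (P R : ℕ → ℤ → ℕ) : Prop where
  P_lt : ∀ n i, P n i < D.q n
  R_lt : ∀ n i, R n i < D.s n
  proj_eq : ∀ n i, P n i = D.proj n (P (n + 1) i)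
  sends : ∀ n i, D.Sends n (R (n + 1) i) (D.wordIndex n (P (n + 1) i)) (R n i)
  shift : ∀ i, ∀ᶠ n in atTop, P n (i + 1) = P n i + 1 ∧ R n (i + 1) = R n i
  inWord : ∀ i, ∃ n, D.InWord P n i

/-- The `i`-th point of the orbit carries the letter `b`. -/
def HasB (P : ℕ → ℤ → ℕ) (i : ℤ) : Prop := ∃ m, D.InWord P (m + 1) i ∧ D.IsBTime m (P (m + 1) i)

variable {D} {P R P' R' : ℕ → ℤ → ℕ} {n : ℕ}

theorem inWord_iff {i : ℤ} :
    D.InWord P n i ↔ D.IsPlain n (P (n + 1) i) ∧ D.InWord P (n + 1) i := by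
  constructor
  · exact fun h => ⟨h n le_rfl, fun m hm => h m (by omega)⟩
  · rintro ⟨h1, h2⟩ m hm
    rcases hm.eq_or_lt with rfl | hm
    · exact h1
    · exact h2 m hm

theorem InWord.mono {m : ℕ} {i : ℤ} (h : D.InWord P n i) (hnm : n ≤ m) : D.InWord P m i :=
  fun m' hm' => h m' (hnm.trans hm')

namespace IsCoding

theorem exists_stage (h : D.IsCoding P R) (n : ℕ) (i j : ℤ) :
    ∃ N, n ≤ N ∧ (P N (i + 1) = P N i + 1 ∧ R N (i + 1) = R N i) ∧ D.InWord P N j := by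
  obtain ⟨N, hN⟩ := eventually_atTop.1 (h.shift i)
  obtain ⟨M, hM⟩ := h.inWord j
  exact ⟨max n (max N M), le_max_left _ _, hN _ (by omega), hM.mono (by omega)⟩

/-- The claim holds at some high stage by `shift` and is handed down: a step inside a word of stage
`m` stays inside one run of stage `m + 1`, so the subword, and with it the row, is unchanged. -/
theorem forward (h : D.IsCoding P R) {i : ℤ} (hi : D.InWord P n i) (hlt : P n i + 1 < D.q n) :
    D.InWord P n (i + 1) ∧ P n (i + 1) = P n i + 1 ∧ R n (i + 1) = R n i := by
  obtain ⟨N, hnN, hN, hw⟩ := h.exists_stage n i (i + 1)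
  revert hi hlt
  induction hnN using Nat.decreasingInduction with
  | self => exact fun _ _ => ⟨hw, hN⟩
  | of_succ m _ ih =>
    intro hi hlt
    rw [h.proj_eq m i] at hlt
    rw [inWord_iff] at hi
    obtain ⟨h1, h2, h3⟩ := hi.1.succ hlt
    obtain ⟨i1, i2, i3⟩ := ih hi.2 (succ_lt_q_succ (h.P_lt _ _) h1)
    refine ⟨inWord_iff.2 ⟨by rwa [i2], i1⟩, by rw [h.proj_eq m, h.proj_eq m i, i2, h3], ?_⟩
    have s1 := h.sends m (i + 1)
    rw [i2, i3, wordIndex_succ h1] at s1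
    exact s1.unique (h.sends m i) (h.R_lt _ _) (h.R_lt _ _)

/-- The same descent. Its hypothesis at stage `m + 1` is automatic, because plain times are
positive. -/
theorem backward (h : D.IsCoding P R) {i : ℤ} (hi : D.InWord P n (i + 1))
    (hlt : 0 < P n (i + 1)) :
    D.InWord P n i ∧ P n (i + 1) = P n i + 1 ∧ R n (i + 1) = R n i := by
  obtain ⟨N, hnN, hN, hw⟩ := h.exists_stage n i i
  revert hi hlt
  induction hnN using Nat.decreasingInduction with
  | self => exact fun _ _ => ⟨hw, hN⟩
  | of_succ m _ ih =>
    intro hi hlt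
    rw [inWord_iff] at hi
    obtain ⟨i1, i2, i3⟩ := ih hi.2 hi.1.pos
    rw [i2] at hi
    have hpos : D.q m < (P (m + 1) i + 1) % D.runLen m + D.shiftAt m (P (m + 1) i + 1) := by
      refine lt_of_le_of_ne hi.1.1 fun he => ?_
      rw [h.proj_eq m, i2, proj, ← he, Nat.mod_self] at hlt
      exact lt_irrefl _ hlt
    obtain ⟨h1, h2⟩ := hi.1.pred fun _ => hpos
    have h0 : D.InWord P m i := inWord_iff.2 ⟨h2, i1⟩
    have hP : P m (i + 1) = P m i + 1 := by
      have e : P m (i + 1) = (P m i + 1) % D.q m := by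
        obtain ⟨hd, hm⟩ := succ_div_mod h1
        rw [h.proj_eq m, h.proj_eq m i, i2, proj, proj, shiftAt, hd, hm, ← shiftAt,
          add_right_comm, Nat.mod_add_mod]
      rcases (Nat.succ_le_of_lt (h.P_lt m i)).lt_or_eq with hlt' | heq
      · rw [e]; exact Nat.mod_eq_of_lt hlt'
      · exfalso
        rw [e, show P m i + 1 = D.q m from heq, Nat.mod_self] at hlt
        exact lt_irrefl _ hlt
    refine ⟨h0, hP, ?_⟩
    have s1 := h.sends m (i + 1)
    rw [i2, i3, wordIndex_succ h1] at s1
    exact s1.unique (h.sends m i) (h.R_lt _ _) (h.R_lt _ _)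

theorem block (h : D.IsCoding P R) {a : ℤ} (ha : D.InWord P n a) (ha0 : P n a = 0) {u : ℕ}
    (hu : u < D.q n) :
    D.InWord P n (a + u) ∧ P n (a + u) = u ∧ R n (a + u) = R n a := by
  induction u with
  | zero => simpa using ⟨ha, ha0⟩
  | succ u ih =>
    obtain ⟨h1, h2, h3⟩ := ih (by omega)
    obtain ⟨f1, f2, f3⟩ := h.forward h1 (by omega)
    have e : a + ((u + 1 : ℕ) : ℤ) = a + u + 1 := by push_cast; ring
    rw [e]
    exact ⟨f1, by omega, f3.trans h3⟩

theorem start (h : D.IsCoding P R) {i : ℤ} (hi : D.InWord P n i) :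
    D.InWord P n (i - P n i) ∧ P n (i - P n i) = 0 := by
  obtain ⟨u, hu⟩ : ∃ u, u = P n i := ⟨_, rfl⟩
  rw [← hu]
  induction u generalizing i with
  | zero => simpa using ⟨hi, hu.symm⟩
  | succ u ih =>
    obtain ⟨b1, b2, -⟩ := h.backward (i := i - 1) (by rwa [sub_add_cancel])
      (by rw [sub_add_cancel]; omega)
    rw [sub_add_cancel] at b2
    have := ih b1 (by omega)
    rwa [show i - ((u + 1 : ℕ) : ℤ) = i - 1 - u by push_cast; ring]

/-- Boundaries between words of stage `n` may be crossed here: a plain time of stage `n + 1` is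
positive, so no new word of stage `n + 1` begins on the way. -/
theorem climb (h : D.IsCoding P R) {b : ℤ} {u : ℕ}
    (hb : ∀ v ≤ u, D.InWord P n (b + v)) : P (n + 1) (b + u) = P (n + 1) b + u := by
  induction u with
  | zero => simp
  | succ u ih =>
    have e : b + ((u + 1 : ℕ) : ℤ) = b + u + 1 := by push_cast; ring
    have h1 := inWord_iff.1 (hb (u + 1) le_rfl)
    rw [e] at h1
    rw [e, (h.backward h1.2 h1.1.pos).2.1, ih fun v hv => hb v (by omega)]
    ring

/-- A word of stage `n + 1` starts with the letters `b^{q_n}`. -/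
theorem isBTime_of_lt_q (hl : ∀ n, 2 ≤ D.l n) {u : ℕ} (hu : u < D.q n) : D.IsBTime n u := by
  have hL := D.two_mul_q_le_runLen hl n
  obtain ⟨h1, h2⟩ := div_mod_of_eq (D := D) (n := n) (t := u) (g := 0) (r := u) (by omega) (by simp)
  have h3 : D.shiftAt n u = 0 := shiftAt_eq_zero (by rw [h1]; exact D.k_pos n)
  have h4 : 0 * D.runLen n + u < D.q (n + 1) := mul_runLen_add_lt (D.k_pos n) (by omega)
  rw [isBTime_iff, h2, h3]
  omega

/-- In the section `i = 0` one has `d_0 = 0`, so the run of index `g` is `b^{q_n} w_g^{l_n - 1}`. -/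
theorem isPlain_mul_add_q (hl : ∀ n, 2 ≤ D.l n) {g : ℕ} (hg : g < D.k n) :
    g * D.runLen n + D.q n < D.q (n + 1) ∧ D.IsPlain n (g * D.runLen n + D.q n) ∧
      D.proj n (g * D.runLen n + D.q n) = 0 ∧ D.wordIndex n (g * D.runLen n + D.q n) = g := by
  have hL := D.two_mul_q_le_runLen hl n
  have hq := D.q_pos n
  obtain ⟨h1, h2⟩ := div_mod_of_eq (D := D) (n := n) (r := D.q n) (g := g) (by omega) rfl
  have h3 : D.shiftAt n (g * D.runLen n + D.q n) = 0 := shiftAt_eq_zero (by rw [h1]; exact hg)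
  refine ⟨mul_runLen_add_lt hg (by omega), ?_, ?_, ?_⟩
  · rw [IsPlain, h2, h3]; omega
  · rw [proj, h2, h3, add_zero, Nat.mod_self]
  · rw [wordIndex, h1, Nat.mod_eq_of_lt hg]

/-- The last stage that inserts a letter is unique, and at one stage a time is not labelled both `b`
and `e`. -/
theorem not_hasB (hl : ∀ n, 2 ≤ D.l n) {i : ℤ}
    (hi : D.InWord P (n + 1) i) (hE : D.IsETime n (P (n + 1) i)) : ¬ D.HasB P i := by
  rintro ⟨m, hm, hB⟩
  have notPlain : ∀ {m t}, D.IsBTime m t ∨ D.IsETime m t → ¬ D.IsPlain m t := by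
    intro m t ht hp
    have hlt : t < D.q (m + 1) := ht.elim (fun h => (D.isBTime_iff.1 h).1)
      fun h => (D.isETime_iff.1 h).1
    rw [isPlain_iff hlt] at hp
    tauto
  rcases lt_trichotomy m n with h | rfl | h
  · exact notPlain (.inr hE) (hm n h)
  · exact not_isBTime_and_isETime hl ⟨hB, hE⟩
  · exact notPlain (.inl hB) (hi m h)

/-- Starts of words of stage `n + 1` agree for two codings with the same letters that agree at
stage `n`. -/
theorem start_transfer (hl : ∀ n, 2 ≤ D.l n) (h : D.IsCoding P R) (h' : D.IsCoding P' R')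
    (hB : ∀ i, D.HasB P i → D.HasB P' i)
    (hG : ∀ i, D.InWord P n i ↔ D.InWord P' n i)
    (hP : ∀ i, D.InWord P n i → P n i = P' n i) {a : ℤ}
    (ha : D.InWord P (n + 1) a) (ha0 : P (n + 1) a = 0) :
    D.InWord P' (n + 1) a ∧ P' (n + 1) a = 0 := by
  -- The induction is on the place of the word inside the word of stage `n + 2`; it is applied to
  -- the word that ends just before `a`.
  induction hN : P (n + 2) a using Nat.strong_induction_on generalizing a with
  | _ N ih =>
  subst hN
  have hq := D.q_pos n
  have hL := D.two_mul_q_le_runLen hl n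
  have hqQ : D.q n < D.q (n + 1) := by
    have := (isPlain_mul_add_q hl (D.k_pos n)).1
    omega
  have hb : ∀ u : ℕ, u < D.q n → D.HasB P (a + u) ∧ ¬ D.InWord P n (a + u) := by
    intro u hu
    obtain ⟨b1, b2, -⟩ := h.block ha ha0 (hu.trans hqQ)
    have hbt := isBTime_of_lt_q hl hu
    refine ⟨⟨n, b1, by rwa [b2]⟩, fun hw => ?_⟩
    have := (inWord_iff.1 hw).1
    rw [b2, isPlain_iff (hu.trans hqQ)] at this
    exact this.1 hbt
  obtain ⟨p1, p2, p3, -⟩ := isPlain_mul_add_q hl (D.k_pos n)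
  rw [zero_mul, zero_add] at p1 p2 p3
  obtain ⟨c1, c2, -⟩ := h.block ha ha0 hqQ
  have hc : D.InWord P n (a + D.q n) := inWord_iff.2 ⟨by rwa [c2], c1⟩
  have hc0 : P n (a + D.q n) = 0 := by rw [h.proj_eq, c2, p3]
  have hc' := (hG _).1 hc
  rw [hP _ hc, h'.proj_eq] at hc0
  obtain ⟨hpl, hc1⟩ := inWord_iff.1 hc'
  obtain ⟨t, ht⟩ : ∃ t, t = P' (n + 1) (a + D.q n) := ⟨_, rfl⟩
  have htlt : t < D.q (n + 1) := ht ▸ h'.P_lt _ _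
  have hst := h'.start hc1
  rw [← ht] at hpl hc0 hst
  have hblock := fun u (hu : u < D.q (n + 1)) => h'.block hst.1 hst.2 hu
  set e : ℤ := a + D.q n - t with he
  obtain ⟨g, hg⟩ : ∃ g, g = t / D.runLen n := ⟨_, rfl⟩
  have htg : t = g * D.runLen n + t % D.runLen n := by
    rw [hg, mul_comm, Nat.div_add_mod]
  -- Otherwise `P'` has the place before `a + q_n` in a word of stage `n`, whereas `P` has an
  -- inserted `b` there.
  have hr : t % D.runLen n + D.shiftAt n t = D.q n := by
    by_contra hne
    obtain ⟨t', rfl⟩ := Nat.exists_eq_succ_of_ne_zero hpl.pos.ne'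
    obtain ⟨-, hpl'⟩ := hpl.pred fun _ => lt_of_le_of_ne hpl.1 (Ne.symm hne)
    obtain ⟨b1, b2, -⟩ := hblock t' (by omega)
    have hw : D.InWord P' n (e + t') := inWord_iff.2 ⟨by rwa [b2], b1⟩
    rw [← hG] at hw
    refine (hb (D.q n - 1) (by omega)).2 ?_
    convert hw using 1
    omega
  -- If `d > 0`, this run of `P'` has only `q_n - d` letters `b`, so the previous run ends at `a + d
  -- - 1`. There `P'` reads an `e`, or a plain letter if that run has no `e`, but `P` has a `b`.
  have hs : D.shiftAt n t = 0 := by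
    by_contra hs
    have hg0 : g ≠ 0 := by
      intro hg0
      exact hs (shiftAt_eq_zero (by rw [← hg, hg0]; exact D.k_pos n))
    obtain ⟨g', rfl⟩ := Nat.exists_eq_succ_of_ne_zero hg0
    have hslt := D.shiftAt_lt n t
    obtain ⟨u, hu⟩ : ∃ u, u = g' * D.runLen n + (D.runLen n - 1) := ⟨_, rfl⟩
    have hut : u + 1 + t % D.runLen n = t := by
      rw [Nat.succ_mul] at htg; omega
    obtain ⟨-, d2⟩ := div_mod_of_eq (D := D) (by omega) hu
    obtain ⟨b1, b2, -⟩ := hblock u (by omega)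
    have hidx : e + u = a + ((D.shiftAt n t - 1 : ℕ) : ℤ) := by omega
    obtain ⟨B1, B2⟩ := hb (D.shiftAt n t - 1) (by omega)
    rw [← hidx] at B1 B2
    rcases Nat.eq_zero_or_pos (D.shiftAt n u) with hz | hz
    · apply B2
      rw [hG]
      refine inWord_iff.2 ⟨?_, b1⟩
      rw [b2, IsPlain, d2, hz]
      omega
    · refine not_hasB hl b1 ?_ (hB _ B1)
      rw [b2, isETime_iff, d2]
      omega
  have hgk : g < D.k n := hg ▸ div_lt_of_shiftAt_eq_zero htlt hs
  rcases Nat.eq_zero_or_pos g with hg0 | hgpos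
  · have hta : t = D.q n := by rw [hg0] at htg; omega
    have : e = a := by omega
    rwa [this] at hst
  -- A run of positive index in the section `i = 0` follows a run without `e`, so `a - 1` lies in a
  -- word of stage `n`.
  exfalso
  obtain ⟨g', rfl⟩ := Nat.exists_eq_succ_of_ne_zero hgpos.ne'
  obtain ⟨u, hu⟩ : ∃ u, u = g' * D.runLen n + (D.runLen n - 1) := ⟨_, rfl⟩
  have hut : u + 1 + D.q n = t := by
    rw [Nat.succ_mul] at htg; omega
  obtain ⟨d1, d2⟩ := div_mod_of_eq (D := D) (by omega) hu
  have hsu : D.shiftAt n u = 0 := shiftAt_eq_zero (by omega)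
  obtain ⟨b1, b2, -⟩ := hblock u (by omega)
  have hidx : e + u = a - 1 := by omega
  rw [hidx] at b1 b2
  have hw : D.InWord P n (a - 1) := by
    rw [hG]
    refine inWord_iff.2 ⟨?_, b1⟩
    rw [b2, IsPlain, d2, hsu]
    omega
  have hw1 := (inWord_iff.1 hw).2
  have hlast : P (n + 1) (a - 1) + 1 = D.q (n + 1) := by
    rcases (Nat.succ_le_of_lt (h.P_lt (n + 1) (a - 1))).lt_or_eq with hlt | heq
    · have := (h.forward hw1 hlt).2.1
      rw [sub_add_cancel] at this
      omega
    · exact heq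
  obtain ⟨s1, s2⟩ := h.start hw1
  -- The word of `P` starting at `a'` ends at `a - 1`. Both words lie in the same word of stage `n +
  -- 2`, so the level there is smaller by `q_{n+1}` at `a'`.
  set a' : ℤ := a - 1 - P (n + 1) (a - 1) with ha'
  have haeq : a = a' + (D.q (n + 1) : ℕ) := by omega
  have hclimb := h.climb (n := n + 1) (b := a') (u := D.q (n + 1)) fun v hv => by
    rcases hv.lt_or_eq with hv | rfl
    · exact (h.block s1 s2 hv).1
    · rwa [← haeq]
  rw [← haeq] at hclimb
  change P (n + 2) a = P (n + 2) a' + D.q (n + 1) at hclimb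
  have hqpos := D.q_pos (n + 1)
  obtain ⟨i1, i2⟩ := ih (P (n + 2) a') (by omega) s1 s2 rfl
  -- By induction `P'` also starts a word at `a'`, which would end at `a - 1`; but its level there
  -- is `u`, with another run still to come.
  obtain ⟨-, b3, -⟩ := h'.block i1 i2 (u := P (n + 1) (a - 1)) (h.P_lt _ _)
  rw [ha', sub_add_cancel, b2] at b3
  have hlt : (g' + 1) * D.runLen n + D.q n < D.q (n + 1) := (isPlain_mul_add_q hl hgk).1
  rw [add_mul] at hlt
  omega

/-- Two codings with the same letters agree. -/
theorem agree (hl : ∀ n, 2 ≤ D.l n) (h3 : D.Requirement3)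
    (h : D.IsCoding P R) (h' : D.IsCoding P' R')
    (hB : ∀ i, D.HasB P i ↔ D.HasB P' i)
    (hG : ∀ i, D.InWord P 0 i ↔ D.InWord P' 0 i)
    (hR : ∀ i, D.InWord P 0 i → R 0 i = R' 0 i) (n : ℕ) :
    (∀ i, D.InWord P n i ↔ D.InWord P' n i) ∧
      ∀ i, D.InWord P n i → P n i = P' n i ∧ R n i = R' n i := by
  induction n with
  | zero =>
    refine ⟨hG, fun i hi => ⟨?_, hR i hi⟩⟩
    have h1 := h.P_lt 0 i
    have h2 := h'.P_lt 0 i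
    rw [D.q_zero] at h1 h2
    omega
  | succ n ih =>
    obtain ⟨iG, iPR⟩ := ih
    have tr : ∀ a, (D.InWord P (n + 1) a ∧ P (n + 1) a = 0) →
        (D.InWord P' (n + 1) a ∧ P' (n + 1) a = 0) := fun a ha =>
      start_transfer hl h h' (fun i => (hB i).1) iG (fun i hi => (iPR i hi).1) ha.1 ha.2
    have tr' : ∀ a, (D.InWord P' (n + 1) a ∧ P' (n + 1) a = 0) →
        (D.InWord P (n + 1) a ∧ P (n + 1) a = 0) := fun a ha =>
      start_transfer hl h' h (fun i => (hB i).2) (fun i => (iG i).symm)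
        (fun i hi => ((iPR i ((iG i).2 hi)).1).symm) ha.1 ha.2
    have rows : ∀ a, D.InWord P (n + 1) a → P (n + 1) a = 0 → R (n + 1) a = R' (n + 1) a := by
      intro a ha ha0
      obtain ⟨ha', ha0'⟩ := tr a ⟨ha, ha0⟩
      -- The letter `j` is read at the first plain place of run `j` in the section `i = 0`, where
      -- the induction hypothesis equates the rows of stage `n`.
      let w : Fin (D.k n) → Fin (D.s n) := fun j =>
        ⟨R n (a + ((j * D.runLen n + D.q n : ℕ) : ℤ)), h.R_lt _ _⟩
      have key := h3 n ⟨_, h.R_lt (n + 1) a⟩ ⟨_, h'.R_lt (n + 1) a⟩ w ?_ ?_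
      · exact congrArg Fin.val key
      · intro j
        obtain ⟨p1, -, -, p4⟩ := isPlain_mul_add_q hl j.2
        obtain ⟨-, b2, b3⟩ := h.block ha ha0 p1
        have := h.sends n (a + ((j * D.runLen n + D.q n : ℕ) : ℤ))
        rwa [b2, b3, p4] at this
      · intro j
        obtain ⟨p1, p2, -, p4⟩ := isPlain_mul_add_q hl j.2
        obtain ⟨b1, b2, -⟩ := h.block ha ha0 p1
        obtain ⟨-, b2', b3'⟩ := h'.block ha' ha0' p1
        have := h'.sends n (a + ((j * D.runLen n + D.q n : ℕ) : ℤ))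
        rw [b2', b3', p4, ← (iPR _ (inWord_iff.2 ⟨by rwa [b2], b1⟩)).2] at this
        exact this
    have main : ∀ i, D.InWord P (n + 1) i →
        D.InWord P' (n + 1) i ∧ P (n + 1) i = P' (n + 1) i ∧ R (n + 1) i = R' (n + 1) i := by
      intro i hi
      obtain ⟨s1, s2⟩ := h.start hi
      obtain ⟨t1, t2⟩ := tr _ ⟨s1, s2⟩
      obtain ⟨-, -, b3⟩ := h.block s1 s2 (h.P_lt (n + 1) i)
      obtain ⟨c1, c2, c3⟩ := h'.block t1 t2 (h.P_lt (n + 1) i)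
      rw [sub_add_cancel] at b3 c1 c2 c3
      exact ⟨c1, c2.symm, by rw [b3, c3, rows _ s1 s2]⟩
    refine ⟨fun i => ⟨fun hi => (main i hi).1, fun hi => ?_⟩, fun i hi => (main i hi).2⟩
    obtain ⟨s1, s2⟩ := tr' _ (h'.start hi)
    have := (h.block s1 s2 (h'.P_lt (n + 1) i)).1
    rwa [sub_add_cancel] at this

end IsCoding

end AbC

/-! ### Weak limits -/

/-- A bound for the points whose `F`-value moves in a forbidden way passes to weak limits. -/
theorem IsWeakLimit.measure_le {X α : Type*} [MeasurableSpace X] [MeasurableSpace α]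
    [DiscreteMeasurableSpace α] {μ : Measure X} {S : ℕ → X ≃ᵐ X} {T : X ≃ᵐ X}
    (hS : ∀ n, MeasurePreserving (S n) μ μ) (hT : MeasurePreserving T μ μ)
    (hlim : IsWeakLimit μ (fun n => S n) T) {F : X → α} (hF : Measurable F) (K : Finset α)
    (hK : ∀ x, F x ∈ K) (G : α → Set α) {c : ENNReal} {n₀ : ℕ}
    (hc : ∀ n, n₀ ≤ n → μ {x | F (S n x) ∉ G (F x)} ≤ c) :
    μ {x | F (T x) ∉ G (F x)} ≤ c := by
  let A : α → Set X := fun f => F ⁻¹' {f}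
  let W : α → Set X := fun f => F ⁻¹' (G f)ᶜ
  have hA : ∀ f, MeasurableSet (A f) := fun f => hF (MeasurableSet.of_discrete)
  have hW : ∀ f, MeasurableSet (W f) := fun f => hF (MeasurableSet.of_discrete)
  -- `F` takes finitely many values, and each piece has the measure of `U A ∩ W`; replacing `S_n` by
  -- `T` changes this by at most the measure of `S_n A ∆ T A`.
  have hdec : ∀ U : X → X, {x | F (U x) ∉ G (F x)} = ⋃ f ∈ K, A f ∩ U ⁻¹' W f := by
    intro U
    ext x
    simp only [Set.mem_ofPred_eq, Set.mem_iUnion, exists_prop]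
    constructor
    · exact fun hx => ⟨F x, hK x, rfl, hx⟩
    · rintro ⟨f, -, rfl, hx⟩
      exact hx
  have himg : ∀ U : X ≃ᵐ X, MeasurePreserving U μ μ → ∀ f,
      μ (A f ∩ U ⁻¹' W f) = μ (U '' A f ∩ W f) := by
    intro U hU f
    rw [← hU.measure_preimage ((U.measurableSet_image.2 (hA f)).inter (hW f)).nullMeasurableSet,
      Set.preimage_inter, U.injective.preimage_image]
  have key : ∀ n, n₀ ≤ n →
      μ {x | F (T x) ∉ G (F x)} ≤ c + ∑ f ∈ K, μ (symmDiff (S n '' A f) (T '' A f)) := by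
    intro n hn
    calc μ {x | F (T x) ∉ G (F x)}
        ≤ ∑ f ∈ K, μ (A f ∩ T ⁻¹' W f) := by
          rw [hdec]; exact measure_biUnion_finset_le _ _
      _ ≤ ∑ f ∈ K, (μ (A f ∩ S n ⁻¹' W f) + μ (symmDiff (S n '' A f) (T '' A f))) := by
          refine Finset.sum_le_sum fun f _ => ?_
          rw [himg T hT, himg (S n) (hS n)]
          refine (measure_mono ?_).trans (measure_union_le _ _)
          rintro x ⟨hx1, hx2⟩
          by_cases hx : x ∈ S n '' A f
          · exact Or.inl ⟨hx, hx2⟩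
          · exact Or.inr (Or.inr ⟨hx1, hx⟩)
      _ = μ {x | F (S n x) ∉ G (F x)} + ∑ f ∈ K, μ (symmDiff (S n '' A f) (T '' A f)) := by
          rw [Finset.sum_add_distrib, hdec, measure_biUnion_finset]
          · intro f _ g _ hfg
            refine Set.disjoint_left.2 ?_
            rintro x ⟨hx, -⟩ ⟨hx', -⟩
            exact hfg (hx.symm.trans hx')
          · exact fun f _ => (hA f).inter ((S n).measurable (hW f))
      _ ≤ _ := by gcongr; exact hc n hn
  have htend : Tendsto (fun n => c + ∑ f ∈ K, μ (symmDiff (S n '' A f) (T '' A f))) atTop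
      (𝓝 (c + ∑ _f ∈ K, 0)) :=
    tendsto_const_nhds.add (tendsto_finsetSum _ fun f _ => hlim (A f) (hA f))
  rw [Finset.sum_const_zero, add_zero] at htend
  exact ge_of_tendsto htend (eventually_atTop.2 ⟨n₀, key⟩)

/-- The rotation as a measurable equivalence. -/
noncomputable def rotEquiv (t : ℝ) : Torus ≃ᵐ Torus :=
  (MeasurableEquiv.addRight (t : UnitAddCircle)).prodCongr (MeasurableEquiv.refl _)

theorem measurePreserving_rotEquiv (t : ℝ) : MeasurePreserving (rotEquiv t) volume volume :=
  (measurePreserving_add_right (volume : Measure UnitAddCircle) (t : UnitAddCircle)).prod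
    (MeasurePreserving.id volume)

/-! ### Almost every orbit is regular -/

namespace AbC

variable (D : AbC)

theorem measurePreserving_H (n : ℕ) : MeasurePreserving (D.H n) volume volume := by
  induction n with
  | zero => exact D.h_measurePreserving 0
  | succ n ih => exact ih.comp (D.h_measurePreserving (n + 1))

theorem measurePreserving_H_symm (n : ℕ) : MeasurePreserving (D.H n).symm volume volume :=
  (D.measurePreserving_H n).symm

/-- The map `T_n` as a measurable equivalence. -/
noncomputable def approxEquiv (n : ℕ) : Torus ≃ᵐ Torus :=
  ((D.H n).symm.trans (rotEquiv (D.α n))).trans (D.H n)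

theorem measurePreserving_approxEquiv (n : ℕ) :
    MeasurePreserving (D.approxEquiv n) volume volume :=
  (D.measurePreserving_H n).comp
    ((measurePreserving_rotEquiv _).comp (D.measurePreserving_H_symm n))

theorem H_symm_approxEquiv (n : ℕ) (x : Torus) :
    (D.H n).symm (D.approxEquiv n x) = rot (D.α n) ((D.H n).symm x) :=
  (D.H n).symm_apply_apply _

/-- The level of `x` in the tower of `T_n`. -/
noncomputable def level (n : ℕ) (x : Torus) : ℕ := D.pos n ((D.H n).symm x)

/-- The row of `x` with respect to the grid carried over by `H_n`. -/
noncomputable def rowAt (n : ℕ) (x : Torus) : ℕ := D.row n ((D.H n).symm x)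

theorem measurable_level (n : ℕ) : Measurable (D.level n) :=
  (Measurable.of_discrete (f := D.back n)).comp
    ((measurable_col _).comp (measurable_fst.comp (D.H n).symm.measurable))

theorem measurable_rowAt (n : ℕ) : Measurable (D.rowAt n) :=
  (measurable_col _).comp (measurable_snd.comp (D.H n).symm.measurable)

theorem level_lt (n : ℕ) (x : Torus) : D.level n x < D.q n := D.pos_lt _ _

theorem rowAt_lt (n : ℕ) (x : Torus) : D.rowAt n x < D.s n := D.row_lt _ _

theorem level_eq_proj (n : ℕ) (x : Torus) : D.level n x = D.proj n (D.level (n + 1) x) := by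
  rw [level, ← D.H_symm_succ, D.pos_h, level]

theorem sends_rowAt (h2 : D.Requirement2) (n : ℕ) (x : Torus) :
    D.Sends n (D.rowAt (n + 1) x) (D.wordIndex n (D.level (n + 1) x)) (D.rowAt n x) := by
  have := D.sends_row h2 n ((D.H (n + 1)).symm x)
  rwa [D.H_symm_succ] at this

theorem pos_rot (n : ℕ) (z : Torus) : D.pos n (rot (D.α n) z) = (D.pos n z + 1) % D.q n := by
  symm
  apply D.eq_back (Nat.mod_lt _ (D.q_pos n))
  have hq0 : (D.q n : ℝ) ≠ 0 := by exact_mod_cast (D.q_pos n).ne'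
  have hcol : col (D.q n) (rot (D.α n) z).1 ≡ col (D.q n) z.1 + D.p n [MOD D.q n] := by
    obtain ⟨v, hv⟩ := exists_rep z.1
    have h1 : (col (D.q n) (rot (D.α n) z).1 : ℤ) = (⌊(D.q n : ℝ) * v⌋ + D.p n) % D.q n := by
      have e : (rot (D.α n) z).1 = ((v + D.α n : ℝ) : UnitAddCircle) := by
        rw [AddCircle.coe_add, hv, rot]
      have e' : (D.q n : ℝ) * (v + D.α n) = (D.q n : ℝ) * v + ((D.p n : ℤ) : ℝ) := by
        rw [α]; push_cast; field_simp
      rw [e, col_coe, e', Int.floor_add_intCast]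
    have h2 := col_coe (D.q n) v
    rw [hv] at h2
    rw [← Int.natCast_modEq_iff]
    push_cast
    rw [h1, h2]
    exact (Int.mod_modEq _ _).trans ((Int.mod_modEq _ _).symm.add_right _)
  refine Nat.ModEq.trans ?_ hcol.symm
  refine ((Nat.mod_modEq _ _).mul_left _).trans ?_
  rw [mul_add, mul_one]
  exact (D.p_mul_back n _).add_right _

/-- From `x` to `y` the level of stage `n` moves up by one and the row does not change. -/
def Advances (n : ℕ) (x y : Torus) : Prop :=
  D.level n y = D.level n x + 1 ∧ D.rowAt n y = D.rowAt n x

theorem advances_approxEquiv {n : ℕ} {x : Torus} (hx : D.level n x + 1 ≠ D.q n) :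
    D.Advances n x (D.approxEquiv n x) := by
  have h := D.level_lt n x
  constructor
  · rw [level, D.H_symm_approxEquiv, D.pos_rot]
    exact Nat.mod_eq_of_lt (by unfold level at *; omega)
  · rw [rowAt, D.H_symm_approxEquiv]
    rfl

/-- The points at the ends of the words of stage `n` or of the runs of stage `n + 1`. -/
def edge (n : ℕ) : Set Torus :=
  {x | D.level n x + 1 = D.q n ∨ D.level (n + 1) x % D.runLen n + 1 = D.runLen n}

variable {D}

/-- Off the edge the step stays inside the run of stage `n + 1`, which fixes the subword, and does
not wrap around modulo `q_n`. -/
theorem Advances.of_succ (h2 : D.Requirement2) {n : ℕ} {x y : Torus}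
    (h : D.Advances (n + 1) x y) (hx : x ∉ D.edge n) : D.Advances n x y := by
  simp only [edge, Set.mem_ofPred_eq, not_or] at hx
  have hr := Nat.mod_lt (D.level (n + 1) x) (D.runLen_pos n)
  have h1 : D.level (n + 1) x % D.runLen n + 1 < D.runLen n := by omega
  have hlt := D.level_lt n x
  constructor
  · have hx1 := hx.1
    rw [D.level_eq_proj n x] at hlt hx1
    rw [D.level_eq_proj n y, D.level_eq_proj n x, h.1, proj, shiftAt, (succ_div_mod h1).1,
      (succ_div_mod h1).2, ← shiftAt, add_right_comm, Nat.add_mod, ← proj, Nat.add_mod_mod]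
    exact Nat.mod_eq_of_lt (by omega)
  · have hy := D.sends_rowAt h2 n y
    rw [h.1, h.2, wordIndex_succ h1] at hy
    exact hy.unique (D.sends_rowAt h2 n x) (D.rowAt_lt _ _) (D.rowAt_lt _ _)

theorem advances_of_le (h2 : D.Requirement2) {n N : ℕ} (hnN : n ≤ N) {x : Torus}
    (hx : ∀ m, n ≤ m → x ∉ D.edge m) : D.Advances n x (D.approxEquiv N x) := by
  induction hnN using Nat.decreasingInduction with
  | self => exact D.advances_approxEquiv fun h => hx N le_rfl (Or.inl h)
  | of_succ m _ ih =>
    exact (ih fun m' hm' => hx m' (by omega)).of_succ h2 (hx m le_rfl)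

theorem volume_level_mem_le (n : ℕ) (S : Finset ℕ) :
    volume {x | D.level n x ∈ S} ≤ S.card * (D.q n : ENNReal)⁻¹ := by
  have hq : (0 : ℝ) < D.q n := by exact_mod_cast D.q_pos n
  have h1 : ∀ t, volume {x | D.level n x = t} ≤ (D.q n : ENNReal)⁻¹ := by
    intro t
    have hlt : D.p n * t % D.q n < D.q n := Nat.mod_lt _ (D.q_pos n)
    have hm : MeasurableSet {u : UnitAddCircle | col (D.q n) u = D.p n * t % D.q n} :=
      measurable_col _ (measurableSet_singleton _)
    have : IsProbabilityMeasure (volume : Measure UnitAddCircle) := ⟨UnitAddCircle.measure_univ⟩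
    have hmp := (measurePreserving_fst (μ := (volume : Measure UnitAddCircle))
      (ν := (volume : Measure UnitAddCircle))).comp (D.measurePreserving_H_symm n)
    calc volume {x | D.level n x = t}
        ≤ volume ((Prod.fst ∘ (D.H n).symm) ⁻¹' {u | col (D.q n) u = D.p n * t % D.q n}) := by
          refine measure_mono ?_
          rintro x rfl
          change col (D.q n) ((D.H n).symm x).1 = D.p n * D.level n x % D.q n
          exact (Nat.mod_eq_of_lt (col_lt (D.q_pos n) _)).symm.trans (D.p_mul_back n _).symm
      _ = volume {u : UnitAddCircle | col (D.q n) u = D.p n * t % D.q n} :=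
          hmp.measure_preimage hm.nullMeasurableSet
      _ ≤ ENNReal.ofReal (1 / D.q n) := volume_col_le (D.q_pos n) hlt
      _ = _ := by rw [one_div, ENNReal.ofReal_inv_of_pos hq, ENNReal.ofReal_natCast]
  have e : {x | D.level n x ∈ S} = ⋃ t ∈ S, {x | D.level n x = t} := by
    ext x; simp
  rw [e]
  refine (measure_biUnion_finset_le _ _).trans ((Finset.sum_le_sum fun t _ => h1 t).trans ?_)
  rw [Finset.sum_const, nsmul_eq_mul]

/-- Each remainder occurs once in each of the `k_n q_n` runs. -/
theorem volume_level_mod_mem_le (n : ℕ) (S : Finset ℕ) :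
    volume {x | D.level (n + 1) x % D.runLen n ∈ S} ≤ S.card * (D.runLen n : ENNReal)⁻¹ := by
  let S' : Finset ℕ := (Finset.range (D.k n * D.q n) ×ˢ S).image fun a => a.1 * D.runLen n + a.2
  have hsub : {x | D.level (n + 1) x % D.runLen n ∈ S} ⊆ {x | D.level (n + 1) x ∈ S'} := by
    intro x hx
    refine Finset.mem_image.2 ⟨(D.level (n + 1) x / D.runLen n, D.level (n + 1) x % D.runLen n),
      Finset.mem_product.2 ⟨Finset.mem_range.2 (D.div_runLen_lt (D.level_lt _ _)), hx⟩, ?_⟩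
    rw [mul_comm, Nat.div_add_mod]
  have hcard : S'.card ≤ D.k n * D.q n * S.card :=
    Finset.card_image_le.trans (by rw [Finset.card_product, Finset.card_range])
  refine (measure_mono hsub).trans ((volume_level_mem_le _ _).trans ?_)
  have hL : (D.runLen n : ENNReal) ≠ 0 := by exact_mod_cast (D.runLen_pos n).ne'
  have hQ : (D.q (n + 1) : ENNReal) ≠ 0 := by exact_mod_cast (D.q_pos (n + 1)).ne'
  rw [← div_eq_mul_inv, ← div_eq_mul_inv, ENNReal.div_le_iff hQ (ENNReal.natCast_ne_top _),
    mul_comm, ← mul_div_assoc, ENNReal.le_div_iff_mul_le (Or.inl hL)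
      (Or.inl (ENNReal.natCast_ne_top _))]
  norm_cast
  calc S'.card * D.runLen n ≤ D.k n * D.q n * S.card * D.runLen n := Nat.mul_le_mul_right _ hcard
    _ = D.q (n + 1) * S.card := by rw [D.q_succ_eq]; ring

theorem volume_edge_le (n : ℕ) : volume (D.edge n) ≤ 2 * (D.q n : ENNReal)⁻¹ := by
  have hqL : D.q n ≤ D.runLen n := Nat.le_mul_of_pos_left _ (D.l_pos n)
  have h1 := volume_level_mem_le (D := D) n {D.q n - 1}
  have h2 := volume_level_mod_mem_le (D := D) n {D.runLen n - 1}
  rw [Finset.card_singleton, Nat.cast_one, one_mul] at h1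
  rw [Finset.card_singleton, Nat.cast_one, one_mul] at h2
  replace h2 := h2.trans (ENNReal.inv_le_inv.2 (Nat.cast_le.2 hqL))
  rw [two_mul]
  refine (measure_mono ?_).trans ((measure_union_le _ _).trans (add_le_add h1 h2))
  rintro x (hx | hx)
  · left
    simp only [Finset.mem_singleton, Set.mem_ofPred_eq]
    omega
  · right
    simp only [Finset.mem_singleton, Set.mem_ofPred_eq]
    omega

theorem volume_not_isPlain_le (n : ℕ) :
    volume {x | ¬ D.IsPlain n (D.level (n + 1) x)} ≤ 2 * (D.l n : ENNReal)⁻¹ := by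
  -- The first and the last `q_n` places of a run contain all inserted letters, whatever `d_i` is.
  let S : Finset ℕ :=
    Finset.range (D.q n) ∪ (Finset.range (D.q n)).image fun u => D.runLen n - 1 - u
  have hsub : {x | ¬ D.IsPlain n (D.level (n + 1) x)}
      ⊆ {x | D.level (n + 1) x % D.runLen n ∈ S} := by
    intro x hx
    have h1 := D.shiftAt_lt n (D.level (n + 1) x)
    have h2 := Nat.mod_lt (D.level (n + 1) x) (D.runLen_pos n)
    simp only [IsPlain, Set.mem_ofPred_eq, not_and_or, not_le, not_lt] at hx
    simp only [S, Set.mem_ofPred_eq, Finset.mem_union, Finset.mem_range, Finset.mem_image]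
    rcases hx with hx | hx
    · left; omega
    · right
      exact ⟨D.runLen n - 1 - D.level (n + 1) x % D.runLen n, by omega, by omega⟩
  have hcard : S.card ≤ 2 * D.q n := by
    refine (Finset.card_union_le _ _).trans ?_
    have := Finset.card_image_le (s := Finset.range (D.q n)) (f := fun u => D.runLen n - 1 - u)
    rw [Finset.card_range] at this ⊢
    omega
  have hq : (D.q n : ENNReal) ≠ 0 := by exact_mod_cast (D.q_pos n).ne'
  calc volume {x | ¬ D.IsPlain n (D.level (n + 1) x)}
      ≤ S.card * (D.runLen n : ENNReal)⁻¹ :=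
        (measure_mono hsub).trans (volume_level_mod_mem_le n S)
    _ ≤ ((2 * D.q n : ℕ) : ENNReal) * (D.runLen n : ENNReal)⁻¹ := by gcongr
    _ = 2 * (D.l n : ENNReal)⁻¹ := by
      rw [runLen]
      push_cast
      rw [ENNReal.mul_inv (Or.inr (ENNReal.natCast_ne_top _)) (Or.inr hq), mul_assoc,
        mul_left_comm _ (D.l n : ENNReal)⁻¹, ENNReal.mul_inv_cancel hq (ENNReal.natCast_ne_top _),
        mul_one]

theorem ae_eventually_advances (hl : ∀ n, 2 ≤ D.l n) (h2 : D.Requirement2) {T : Torus ≃ᵐ Torus}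
    (hT : MeasurePreserving T volume volume) (hlim : IsWeakLimit volume D.approx T) :
    ∀ᵐ x, ∀ᶠ n in atTop, D.Advances n x (T x) := by
  -- For `N ≥ n` the map `T_N` advances at stage `n` off the edges of stages `m ≥ n`, whose measures
  -- are at most `2 · 2^{-m}`. The bound does not depend on `N`, so it passes to `T`.
  have hbad : ∀ n, volume {x | ¬ D.Advances n x (T x)} ≤ 4 * (2⁻¹ : ENNReal) ^ n := by
    intro n
    refine IsWeakLimit.measure_le (α := ℕ × ℕ) (n₀ := n) D.measurePreserving_approxEquiv hT hlim
      ((D.measurable_level n).prodMk (D.measurable_rowAt n))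
      (Finset.range (D.q n) ×ˢ Finset.range (D.s n))
      (fun x => Finset.mem_product.2
        ⟨Finset.mem_range.2 (D.level_lt n x), Finset.mem_range.2 (D.rowAt_lt n x)⟩)
      (fun f => {g | g.1 = f.1 + 1 ∧ g.2 = f.2}) ?_
    intro N hN
    have hsub : {x | ¬ D.Advances n x (D.approxEquiv N x)} ⊆ ⋃ m, D.edge (n + m) := by
      intro x hx
      by_contra hne
      rw [Set.mem_iUnion, not_exists] at hne
      refine hx (advances_of_le h2 hN fun m hm => ?_)
      have := hne (m - n)
      rwa [Nat.add_sub_cancel' hm] at this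
    calc volume {x | ¬ D.Advances n x (D.approxEquiv N x)}
        ≤ ∑' m, volume (D.edge (n + m)) := (measure_mono hsub).trans (measure_iUnion_le _)
      _ ≤ ∑' m, 2 * (2⁻¹ : ENNReal) ^ n * (2⁻¹ : ENNReal) ^ m := by
          refine ENNReal.tsum_le_tsum fun m => (volume_edge_le _).trans ?_
          rw [mul_assoc, ← pow_add, ← ENNReal.inv_pow]
          gcongr
          exact_mod_cast D.two_pow_le_q hl (n + m)
      _ = 4 * (2⁻¹ : ENNReal) ^ n := by
          rw [ENNReal.tsum_mul_left, ENNReal.tsum_geometric, ENNReal.one_sub_inv_two, inv_inv]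
          ring
  refine ae_eventually_notMem (s := fun n => {x | ¬ D.Advances n x (T x)}) ?_ |>.mono ?_
  · refine ne_top_of_le_ne_top ?_ (ENNReal.tsum_le_tsum hbad)
    rw [ENNReal.tsum_mul_left, ENNReal.tsum_geometric, ENNReal.one_sub_inv_two, inv_inv]
    exact ENNReal.mul_ne_top (by simp) (by simp)
  · intro x hx
    filter_upwards [hx] with n hn
    exact not_not.1 hn

theorem ae_eventually_isPlain (hl_sum : Summable (fun n => (1 : ℝ) / (D.l n : ℝ))) :
    ∀ᵐ x, ∀ᶠ n in atTop, D.IsPlain n (D.level (n + 1) x) := by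
  refine ae_eventually_notMem (s := fun n => {x | ¬ D.IsPlain n (D.level (n + 1) x)}) ?_ |>.mono ?_
  · refine ne_top_of_le_ne_top ?_ (ENNReal.tsum_le_tsum volume_not_isPlain_le)
    rw [ENNReal.tsum_mul_left]
    refine ENNReal.mul_ne_top (by simp) ?_
    have e : ∀ n, (D.l n : ENNReal)⁻¹ = ENNReal.ofReal (1 / (D.l n : ℝ)) := by
      intro n
      have : (0 : ℝ) < D.l n := by exact_mod_cast D.l_pos n
      rw [one_div, ENNReal.ofReal_inv_of_pos this, ENNReal.ofReal_natCast]
    simp_rw [e]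
    exact hl_sum.tsum_ofReal_ne_top
  · intro x hx
    filter_upwards [hx] with n hn
    exact not_not.1 hn

end AbC

/-! ### Separating itineraries generate -/

theorem MeasurableEquiv.measurePreserving_zpow {X : Type*} [MeasurableSpace X] {μ : Measure X}
    {T : X ≃ᵐ X} (hT : MeasurePreserving T μ μ) (i : ℤ) :
    MeasurePreserving ⇑((T.toEquiv : Equiv.Perm X) ^ i) μ μ := by
  have hnat : ∀ (U : X ≃ᵐ X), MeasurePreserving U μ μ → ∀ m : ℕ,
      MeasurePreserving ⇑((U.toEquiv : Equiv.Perm X) ^ m) μ μ := by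
    intro U hU m
    rw [Equiv.Perm.coe_pow]
    exact hU.iterate m
  cases i with
  | ofNat m => exact hnat T hT m
  | negSucc m =>
    rw [zpow_negSucc, ← inv_pow]
    exact hnat T.symm hT.symm (m + 1)

/-- A countable family of measurable sets generates `T` if the itinerary determines almost every
point. -/
theorem generates_of_injOn {X ι : Type*} [MeasurableSpace X] [StandardBorelSpace X] [Countable ι]
    {μ : Measure X} {T : X ≃ᵐ X} (hT : MeasurePreserving T μ μ) {P : ι → Set X}
    (hP : ∀ a, MeasurableSet (P a)) {p : X → Prop} (hp : ∀ᵐ x ∂μ, p x)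
    (hinj : ∀ x y, p x → p y → (∀ (i : ℤ) (a : ι), ((T.toEquiv : Equiv.Perm X) ^ i) x ∈ P a ↔
      ((T.toEquiv : Equiv.Perm X) ^ i) y ∈ P a) → x = y) :
    Generates μ T P := by
  intro A hA
  obtain ⟨Y, hYp, hY, hYμ⟩ : ∃ Y : Set X, (∀ x ∈ Y, p x) ∧ MeasurableSet Y ∧ μ Yᶜ = 0 := by
    obtain ⟨Z, hZ, hZm, hZμ⟩ := exists_measurable_superset_of_null (ae_iff.1 hp)
    exact ⟨Zᶜ, fun x hx => by_contra fun h => hx (hZ h), hZm.compl, by rwa [compl_compl]⟩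
  let f : X → ℤ × ι → Prop := fun x c => ((T.toEquiv : Equiv.Perm X) ^ c.1) x ∈ P c.2
  have hf : Measurable f := measurable_pi_iff.2 fun c => measurable_to_prop (by
    have := (MeasurableEquiv.measurePreserving_zpow hT c.1).measurable (hP c.2)
    convert this using 1
    ext x
    simp [f])
  have hinjOn : Set.InjOn f (A ∩ Y) := by
    intro x hx y hy hxy
    exact hinj x y (hYp x hx.2) (hYp y hy.2) fun i a => (congrFun hxy (i, a)).to_iff
  -- Lusin–Souslin: an injective measurable image of a Borel set is Borel. The preimage of this
  -- image differs from `A` only outside `Y`.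
  have himg : MeasurableSet (f '' (A ∩ Y)) :=
    (hA.inter hY).image_of_measurable_injOn hf hinjOn
  refine ⟨f ⁻¹' (f '' (A ∩ Y)), ?_, ?_⟩
  · have hf' : @Measurable X (ℤ × ι → Prop) (MeasurableSpace.generateFrom
        {S : Set X | ∃ (i : ℤ) (a : ι), S = ((T.toEquiv : Equiv.Perm X) ^ i) ⁻¹' P a}) _ f := by
      refine @measurable_pi_lambda _ _ _ (_) _ _ fun c => ?_
      refine @measurable_to_prop _ (_) _ ?_
      refine MeasurableSpace.measurableSet_generateFrom ⟨c.1, c.2, ?_⟩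
      ext x
      simp [f]
    exact hf' himg
  · have hYae : ∀ᵐ x ∂μ, x ∈ Y := hYμ
    filter_upwards [hYae] with x hx
    refine propext ⟨fun hxA => ⟨x, ⟨hxA, hx⟩, rfl⟩, ?_⟩
    rintro ⟨y, ⟨hyA, hyY⟩, hyx⟩
    have := hinj y x (hYp y hyY) (hYp x hx) fun i a => (congrFun hyx (i, a)).to_iff
    exact this ▸ hyA

/-! ### The partition `Q` and its itineraries -/

namespace AbC

variable {D : AbC}

theorem mem_Γ_iff {n : ℕ} {x : Torus} :
    x ∈ D.Γ n ↔ ∀ m, n ≤ m → D.IsPlain m (D.level (m + 1) x) := by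
  have key : ∀ m, (D.H (m + 1)).symm x ∉ D.stageB (m + 1) ∪ D.stageE (m + 1) ↔
      D.IsPlain m (D.level (m + 1) x) := by
    intro m
    rw [isPlain_iff (D.level_lt _ _), Set.mem_union, not_or, mem_stageB_iff, mem_stageE_iff, level]
  constructor
  · exact fun h m hm => (key m).1 (h (m + 1) (by omega))
  · intro h m hm
    obtain ⟨m, rfl⟩ := Nat.exists_eq_succ_of_ne_zero (show m ≠ 0 by omega)
    exact (key m).2 (h m (by omega))

theorem mem_setB_iff {x : Torus} :
    x ∈ D.setB ↔ ∃ m, x ∈ D.Γ (m + 1) ∧ D.IsBTime m (D.level (m + 1) x) := by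
  constructor
  · rintro ⟨m, h1, h2⟩
    cases m with
    | zero => exact h2.elim
    | succ m => exact ⟨m, h1, D.mem_stageB_iff.1 h2⟩
  · rintro ⟨m, h1, h2⟩
    exact ⟨m + 1, h1, D.mem_stageB_iff.2 h2⟩

theorem mem_setE_iff {x : Torus} :
    x ∈ D.setE ↔ ∃ m, x ∈ D.Γ (m + 1) ∧ D.IsETime m (D.level (m + 1) x) := by
  constructor
  · rintro ⟨m, h1, h2⟩
    cases m with
    | zero => exact h2.elim
    | succ m => exact ⟨m, h1, D.mem_stageE_iff.1 h2⟩
  · rintro ⟨m, h1, h2⟩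
    exact ⟨m + 1, h1, D.mem_stageE_iff.2 h2⟩

theorem measurableSet_Γ (n : ℕ) : MeasurableSet (D.Γ n) := by
  have e : D.Γ n = ⋂ (m : ℕ) (_ : n ≤ m), D.level (m + 1) ⁻¹' {t | D.IsPlain m t} := by
    ext x
    rw [mem_Γ_iff]
    simp
  rw [e]
  exact .iInter fun m => .iInter fun _ => D.measurable_level _ .of_discrete

theorem measurableSet_setB : MeasurableSet D.setB := by
  have e : D.setB = ⋃ m, D.Γ (m + 1) ∩ D.level (m + 1) ⁻¹' {t | D.IsBTime m t} := by
    ext x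
    rw [mem_setB_iff]
    simp
  rw [e]
  exact .iUnion fun m => (measurableSet_Γ _).inter (D.measurable_level _ .of_discrete)

theorem measurableSet_setE : MeasurableSet D.setE := by
  have e : D.setE = ⋃ m, D.Γ (m + 1) ∩ D.level (m + 1) ⁻¹' {t | D.IsETime m t} := by
    ext x
    rw [mem_setE_iff]
    simp
  rw [e]
  exact .iUnion fun m => (measurableSet_Γ _).inter (D.measurable_level _ .of_discrete)

theorem disjoint_setB_setE (hl : ∀ n, 2 ≤ D.l n) : Disjoint D.setB D.setE := by
  rw [Set.disjoint_left]
  intro x hB hE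
  obtain ⟨m, h1, h2⟩ := mem_setB_iff.1 hB
  obtain ⟨n, h3, h4⟩ := mem_setE_iff.1 hE
  -- No dynamics enters here, so a sequence constant in the time variable serves.
  refine IsCoding.not_hasB (P := fun n _ => D.level n x) (i := 0) hl (mem_Γ_iff.1 h3) h4
    ⟨m, mem_Γ_iff.1 h1, h2⟩

/-- If finitely many but some letters are inserted, there is a last one, and it puts `x` into `B` or
`E`. -/
theorem mem_Γ_zero_iff {x : Torus} (hx : ∃ n, x ∈ D.Γ n) :
    x ∈ D.Γ 0 ↔ x ∉ D.setB ∪ D.setE := by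
  constructor
  · rintro h (hB | hE)
    · obtain ⟨m, -, h2⟩ := mem_setB_iff.1 hB
      exact ((isPlain_iff (D.level_lt _ _)).1 (mem_Γ_iff.1 h m (Nat.zero_le m))).1 h2
    · obtain ⟨m, -, h2⟩ := mem_setE_iff.1 hE
      exact ((isPlain_iff (D.level_lt _ _)).1 (mem_Γ_iff.1 h m (Nat.zero_le m))).2 h2
  · intro h
    obtain ⟨n, hn⟩ := hx
    induction n with
    | zero => exact hn
    | succ n ih =>
      refine ih (mem_Γ_iff.2 fun m hm => ?_)
      rcases hm.eq_or_lt with rfl | hm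
      · rw [isPlain_iff (D.level_lt _ _)]
        exact ⟨fun hB => h (.inl (mem_setB_iff.2 ⟨_, hn, hB⟩)),
          fun hE => h (.inr (mem_setE_iff.2 ⟨_, hn, hE⟩))⟩
      · exact mem_Γ_iff.1 hn m hm

theorem mem_Q_a_iff {i : Fin (D.s 0)} {x : Torus} :
    x ∈ D.Q (.a i) ↔ D.rowAt 0 x = i ∧ x ∉ D.setB ∪ D.setE := by
  have e : x ∈ D.H 0 '' rect 1 (D.s 0) 0 i ↔ D.rowAt 0 x = i := by
    rw [← (D.H 0).coe_toEquiv, (D.H 0).toEquiv.image_eq_preimage_symm]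
    change ((D.H 0).symm x).1 ∈ arc 1 0 ∧ ((D.H 0).symm x).2 ∈ arc (D.s 0) i ↔ _
    rw [mem_arc_of_lt one_pos, mem_arc_of_lt i.2, rowAt, row]
    exact and_iff_right (col_one _)
  change x ∈ D.H 0 '' rect 1 (D.s 0) 0 i ∧ x ∉ _ ↔ _
  rw [e]

theorem isMeasurablePartition_Q (hl : ∀ n, 2 ≤ D.l n) : IsMeasurablePartition volume D.Q where
  measurableSet
    | .a i => by
      have e : D.Q (.a i) = D.rowAt 0 ⁻¹' {(i : ℕ)} \ (D.setB ∪ D.setE) := by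
        ext x
        exact mem_Q_a_iff
      rw [e]
      exact (D.measurable_rowAt 0 .of_discrete).diff
        (measurableSet_setB.union measurableSet_setE)
    | .b => measurableSet_setB
    | .e => measurableSet_setE
  disjoint := by
    have hBE := disjoint_setB_setE hl
    have ha : ∀ i, Disjoint (D.Q (.a i)) (D.setB ∪ D.setE) := fun i => Set.disjoint_sdiff_left
    rintro (i | _ | _) (j | _ | _) hne
    · rw [Set.disjoint_left]
      intro x hx hx'
      rw [mem_Q_a_iff] at hx hx'
      exact hne (congrArg _ (Fin.ext (hx.1.symm.trans hx'.1)))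
    · exact (ha i).mono_right Set.subset_union_left
    · exact (ha i).mono_right Set.subset_union_right
    · exact ((ha j).mono_right Set.subset_union_left).symm
    · exact absurd rfl hne
    · exact hBE
    · exact ((ha j).mono_right Set.subset_union_right).symm
    · exact hBE.symm
    · exact absurd rfl hne
  ae_mem := by
    have e : ⋃ a, D.Q a = Set.univ := by
      refine Set.eq_univ_of_forall fun x => Set.mem_iUnion.2 ?_
      by_cases hB : x ∈ D.setB
      · exact ⟨.b, hB⟩
      by_cases hE : x ∈ D.setE
      · exact ⟨.e, hE⟩
      exact ⟨.a ⟨_, D.rowAt_lt 0 x⟩, mem_Q_a_iff.2 ⟨rfl, fun h => h.elim hB hE⟩⟩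
    rw [e, Set.compl_univ, measure_empty]

/-- The orbit of `x` is coded by the levels and rows of its points at all large stages. -/
def IsRegular (D : AbC) (T : Torus ≃ᵐ Torus) (x : Torus) : Prop :=
  ∀ i : ℤ, (∀ᶠ n in atTop, D.Advances n (((T.toEquiv : Equiv.Perm Torus) ^ i) x)
      (T (((T.toEquiv : Equiv.Perm Torus) ^ i) x))) ∧
    ∀ᶠ n in atTop, D.IsPlain n (D.level (n + 1) (((T.toEquiv : Equiv.Perm Torus) ^ i) x))

theorem ae_isRegular (hl : ∀ n, 2 ≤ D.l n)
    (hl_sum : Summable (fun n => (1 : ℝ) / (D.l n : ℝ))) (h2 : D.Requirement2) {T : Torus ≃ᵐ Torus}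
    (hT : MeasurePreserving T volume volume) (hlim : IsWeakLimit volume D.approx T) :
    ∀ᵐ x, D.IsRegular T x := by
  refine ae_all_iff.2 fun i => ?_
  have hi := (MeasurableEquiv.measurePreserving_zpow hT i).quasiMeasurePreserving
  exact (hi.ae (ae_eventually_advances hl h2 hT hlim)).and (hi.ae (ae_eventually_isPlain hl_sum))

theorem IsRegular.isCoding (h2 : D.Requirement2) {T : Torus ≃ᵐ Torus} {x : Torus}
    (hx : D.IsRegular T x) :
    D.IsCoding (fun n i => D.level n (((T.toEquiv : Equiv.Perm Torus) ^ i) x))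
      (fun n i => D.rowAt n (((T.toEquiv : Equiv.Perm Torus) ^ i) x)) where
  P_lt _ _ := D.level_lt _ _
  R_lt _ _ := D.rowAt_lt _ _
  proj_eq _ _ := D.level_eq_proj _ _
  sends _ _ := D.sends_rowAt h2 _ _
  shift i := by
    have e : ((T.toEquiv : Equiv.Perm Torus) ^ (i + 1)) x
        = T (((T.toEquiv : Equiv.Perm Torus) ^ i) x) := by
      rw [add_comm, zpow_one_add]
      rfl
    rw [e]
    exact (hx i).1
  inWord i := by
    obtain ⟨n, hn⟩ := eventually_atTop.1 (hx i).2
    exact ⟨n, hn⟩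

/-- The itinerary supplies the input of `IsCoding.agree`: `B` marks the letters `b`, the complement
of `B ∪ E` the stage 0 words, and the sets `A_i` their rows. Its output at time 0 is what
`eq_of_forall_pos_row` needs. -/
theorem IsRegular.eq_of_forall_mem_iff (hl : ∀ n, 2 ≤ D.l n) (h1 : D.Requirement1)
    (h2 : D.Requirement2) (h3 : D.Requirement3) {T : Torus ≃ᵐ Torus} {x y : Torus}
    (hx : D.IsRegular T x) (hy : D.IsRegular T y)
    (h : ∀ (i : ℤ) a, ((T.toEquiv : Equiv.Perm Torus) ^ i) x ∈ D.Q a ↔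
      ((T.toEquiv : Equiv.Perm Torus) ^ i) y ∈ D.Q a) : x = y := by
  have cx := hx.isCoding h2
  have cy := hy.isCoding h2
  have hΓ : ∀ {z : Torus}, D.IsRegular T z → ∀ i : ℤ,
      D.InWord (fun n i => D.level n (((T.toEquiv : Equiv.Perm Torus) ^ i) z)) 0 i ↔
        ((T.toEquiv : Equiv.Perm Torus) ^ i) z ∉ D.setB ∪ D.setE := by
    intro z hz i
    obtain ⟨n, hn⟩ := (hz.isCoding h2).inWord i
    rw [← mem_Γ_zero_iff ⟨n, mem_Γ_iff.2 hn⟩, mem_Γ_iff]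
    rfl
  have hB : ∀ (z : Torus) (i : ℤ),
      D.HasB (fun n i => D.level n (((T.toEquiv : Equiv.Perm Torus) ^ i) z)) i ↔
        ((T.toEquiv : Equiv.Perm Torus) ^ i) z ∈ D.setB := by
    intro z i
    simp only [mem_setB_iff, mem_Γ_iff]
    rfl
  have key := IsCoding.agree hl h3 cx cy (fun i => by rw [hB, hB]; exact h i .b)
    (fun i => by
      rw [hΓ hx, hΓ hy, Set.mem_union, Set.mem_union]
      exact not_congr (or_congr (h i .b) (h i .e)))
    (fun i hi => by
      rw [hΓ hx] at hi
      have := (h i (.a ⟨_, D.rowAt_lt 0 _⟩)).1 (mem_Q_a_iff.2 ⟨rfl, hi⟩)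
      exact (mem_Q_a_iff.1 this).1.symm)
  refine D.eq_of_forall_pos_row hl h1 h2 ?_
  obtain ⟨n, hn⟩ := cx.inWord 0
  filter_upwards [eventually_ge_atTop n] with m hm
  exact (key m).2 0 (hn.mono hm)

instance (m : ℕ) : Countable (Letter m) := by
  refine Function.Injective.countable
    (f := fun c : Letter m => (match c with | .a i => some (some i) | .b => none | .e => some none :
      Option (Option (Fin m)))) ?_
  rintro (i | _ | _) (j | _ | _) h <;> simp_all

end AbC

theorem lemma55 (D : AbC)
    (hl : ∀ n, 2 ≤ D.l n) (hl_sum : Summable (fun n => (1 : ℝ) / (D.l n : ℝ)))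
    (T : Torus ≃ᵐ Torus) (hT : MeasurePreserving T volume volume)
    (hT_lim : IsWeakLimit volume D.approx T)
    (h1 : D.Requirement1) (h2 : D.Requirement2) (h3 : D.Requirement3) :
    IsMeasurablePartition volume D.Q ∧ Generates volume T D.Q := by
  have hQ := AbC.isMeasurablePartition_Q hl
  exact ⟨hQ, generates_of_injOn hT hQ.measurableSet (AbC.ae_isRegular hl hl_sum h2 hT hT_lim)
    fun _ _ hx hy h => hx.eq_of_forall_mem_iff hl h1 h2 h3 hy h⟩
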